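/- All graphs are finite and directed, without parallel edges, and carry a distinguished source $s(G)$; isomorphisms are required to preserve edges in both directions and the distinguished source. A sink is a vertex that reaches only itself. $N^+(v)$ and $N^-(v)$ are the sets of out- and in-neighbours of $v$, and $N^{2+}(v)=N^+(N^+(v))$. \emph{Statement graphs.} These are (with source $v$): the trivial graph (one vertex, type $1$); the sequence $v\to w$ (type $2$); the if graph $v\to w\to t$, $v\to t$ (type $3$); the while graph $v\to w\to v$, $v\to t$ (type $4$); the repeat graph $v\to w\to v$, $w\to t$ (type $5$); the if-then-else graph $v\to w_1\to t$, $v\to w_2\to t$ (type $6$); and for $p\ge 3$ the $p$-case graph $v\to w_i\to t$, $1\le i\le p$ (type $p+4$). The sink is $v$ in the trivial graph, $w$ in the sequence, and $t$ otherwise. \emph{Dijkstra graphs.} Some vertices are called expansible. The trivial graph, with its vertex expansible, is a Dijkstra graph. If $G$ is a Dijkstra graph and $a$ an expansible vertex of $G$, then replacing $a$ by a copy $H$ (on new vertices) of a non-trivial statement graph, so that the in-edges of $a$ become in-edges of the source $s(H)$ and the out-edges of $a$ become out-edges of the sink $t(H)$, gives a Dijkstra graph, with source $s(H)$ if $a=s(G)$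 and $s(G)$ otherwise; its expansible vertices are those of $G$ other than $a$ and those of $H$ other than $s(H)$. \emph{Prime subgraphs.} An edge $ab$ is a cycle edge if in a depth-first search from $s(G)$ the vertex $a$ is inserted in the stack after $b$ and before the removal of $b$ (for Dijkstra graphs this does not depend on the search). An induced subgraph $H$ of $G$ with source $s(H)$ and sink $t(H)$ is prime if it is isomorphic to a non-trivial statement graph, by an isomorphism that preserves the source and under which cycle edges of the statement graph correspond exactly to cycle edges of $G$, and if it is closed: in-edges of vertices of $H$ other than $s(H)$ and out-edges of vertices of $H$ other than $t(H)$ have both ends in $H$, and $u\in N^+(s(H))$ for every cycle edge $u\,s(H)$ of $G$. Contracting $H$ identifies all its vertices with $s(H)$ and removes loops and parallel edges. \emph{The code.} Let $G$ be a Dijkstra graph and $v_1,\dots,v_n$ a topological sort of $G$ minus its cycle edges. Start with $C(v):=1$ for all $v$. For $i=n,n-1,\dots,1$: if $v_i$ is the source of a prime subgraph $H$ of the current graph, put $C(v_i):=C(v_i)\,\|\,C(H)$ and contract $H$. Here, with $v=s(H)$, all neighbourhoods taken in $H$, and $\mathrm{lex}(C(S))$ denoting the concatenation of the codes of the vertices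 of $S$ in lexicographically non-decreasing order, $C(H)$ is \begin{itemize} \item $2\,\|\,C(N^+(v))$ for a sequence graph; \item $3\,\|\,C(N^+(v)\setminus N^{2+}(v))\,\|\,C(N^{2+}(v))$ for an if graph; \item $4\,\|\,C(N^+(v)\cap N^-(v))\,\|\,C(N^+(v)\setminus N^-(v))$ for a while graph; \item $5\,\|\,C(N^+(v))\,\|\,C(N^{2+}(v)\setminus\{v\})$ for a repeat graph; \item $6\,\|\,\mathrm{lex}(C(N^+(v)))\,\|\,C(N^{2+}(v))$ for an if-then-else graph; \item $(p+4)\,\|\,\mathrm{lex}(C(N^+(v)))\,\|\,C(N^{2+}(v))$ for a $p$-case graph. \end{itemize} The code $C(G)$ is the final string $C(s(G))$. Each $1$ in it corresponds to the vertex $v$ for which it was written as the initial value $C(v):=1$ (where vertices of equal codes are to be ordered, any order may be chosen). \textbf{Theorem.} Let $G,G'$ be Dijkstra graphs. \begin{enumerate} \item The code $C(G)$ exists and is unique: it does not depend on the topological sort or on any other choice. \item For every run of the algorithm, the $1$'s of $C(G)$ correspond bijectively to the vertices of $G$. \item If $C(G)=C(G')$ then, for any runs of the algorithm on $G$ and on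 $G'$, an isomorphism $f$ from $G$ to $G'$ is obtained by putting $f(v):=v'$ whenever $v\in V(G)$ and $v'\in V(G')$ correspond to $1$'s at the same position of $C(G)$ and $C(G')$. \item The code represents the graph: $C(G)=C(G')$ if and only if $G$ and $G'$ are isomorphic. \end{enumerate} -/

import Mathlib

universe u v

/-- A finite directed graph, without parallel edges, whose vertices are taken from `V`, together
with a distinguished vertex `source`. -/
structure RootedDigraph (V : Type u) where
  verts : Finset V
  Adj : V → V → Prop
  source : V
  source_mem : source ∈ verts
  left_mem : ∀ {a b : V}, Adj a b → a ∈ verts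
  right_mem : ∀ {a b : V}, Adj a b → b ∈ verts

namespace RootedDigraph

variable {V : Type u} {W : Type v}

/-- Out-neighbours `N⁺(a)`. -/
def outNbr (G : RootedDigraph V) (a : V) : Set V := {b | G.Adj a b}

/-- In-neighbours `N⁻(a)`. -/
def inNbr (G : RootedDigraph V) (a : V) : Set V := {b | G.Adj b a}

/-- `N⁺(N⁺(a))`. -/
def outNbr2 (G : RootedDigraph V) (a : V) : Set V := {c | ∃ b, G.Adj a b ∧ G.Adj b c}

/-- A sink reaches no vertex except itself. -/
def IsSink (G : RootedDigraph V) (t : V) : Prop :=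
  t ∈ G.verts ∧ ∀ b, Relation.ReflTransGen G.Adj t b → b = t

/-- `f` is an isomorphism of graphs with distinguished source. -/
def IsIso (G : RootedDigraph V) (H : RootedDigraph W) (f : G.verts ≃ H.verts) : Prop :=
  (f ⟨G.source, G.source_mem⟩ : W) = H.source ∧
    ∀ a b : G.verts, G.Adj a b ↔ H.Adj (f a) (f b)

/-- Partial depth-first searches of `G` from its source: `DFSState G stack visited` says that
some depth-first search reaches a moment at which the stack is `stack` (top first) and the set of
vertices inserted so far is `visited`. A vertex is removed when it has no unvisited
out-neighbour. -/
inductive DFSState (G : RootedDigraph V) : List V → Set V → Prop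
  | start : DFSState G [G.source] {G.source}
  | push {a b : V} {stack : List V} {visited : Set V} :
      DFSState G (a :: stack) visited → G.Adj a b → b ∉ visited →
      DFSState G (b :: a :: stack) (insert b visited)
  | pop {a : V} {stack : List V} {visited : Set V} :
      DFSState G (a :: stack) visited → (∀ b, G.Adj a b → b ∈ visited) →
      DFSState G stack visited

/-- The edge `ab` is a cycle edge: in a depth-first search from the source, `a` is inserted in
the stack after `b` and before the removal of `b`. (In a reducible graph this does not depend on
the search.) -/
def IsCycleEdge (G : RootedDigraph V) (a b : V) : Prop :=
  G.Adj a b ∧ ∃ stack visited, DFSState G (a :: stack) visited ∧ b ∈ stack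

/-- A topological sort of `G` minus its cycle edges. -/
def IsTopologicalSort (G : RootedDigraph V) (L : List V) : Prop :=
  L.Nodup ∧ (∀ a, a ∈ L ↔ a ∈ G.verts) ∧
    ∀ (i j : ℕ) (a b : V), L[i]? = some a → L[j]? = some b →
      G.Adj a b → ¬ G.IsCycleEdge a b → i < j

end RootedDigraph

/-- The kinds of statement graphs. -/
inductive StatementKind where
  | trivial
  | sequence
  | ifThen
  | while
  | repeat
  | ifThenElse
  | pCase (p : ℕ) (hp : 3 ≤ p)

namespace StatementKind

/-- The integers `type(H)`. -/
def typeNumber : StatementKind → ℕ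
  | .trivial => 1
  | .sequence => 2
  | .ifThen => 3
  | .while => 4
  | .repeat => 5
  | .ifThenElse => 6
  | .pCase p _ => p + 4

/-- The statement graphs have vertices `0, …, lastVertex`, with source `0` and with sink
`lastVertex`. -/
def lastVertex : StatementKind → ℕ
  | .trivial => 0
  | .sequence => 1
  | .ifThen => 2
  | .while => 2
  | .repeat => 2
  | .ifThenElse => 3
  | .pCase p _ => p + 1

/-- The edges of the statement graphs. -/
def Edge : StatementKind → ℕ → ℕ → Prop
  | .trivial, _, _ => False
  | .sequence, a, b => a = 0 ∧ b = 1
  | .ifThen, a, b => (a = 0 ∧ b = 1) ∨ (a = 1 ∧ b = 2) ∨ (a = 0 ∧ b = 2)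
  | .while, a, b => (a = 0 ∧ b = 1) ∨ (a = 1 ∧ b = 0) ∨ (a = 0 ∧ b = 2)
  | .repeat, a, b => (a = 0 ∧ b = 1) ∨ (a = 1 ∧ b = 0) ∨ (a = 1 ∧ b = 2)
  | .ifThenElse, a, b =>
      (a = 0 ∧ b = 1) ∨ (a = 0 ∧ b = 2) ∨ (a = 1 ∧ b = 3) ∨ (a = 2 ∧ b = 3)
  | .pCase p _, a, b =>
      (a = 0 ∧ 1 ≤ b ∧ b ≤ p) ∨ (1 ≤ a ∧ a ≤ p ∧ b = p + 1)

/-- The statement graph of a given kind. -/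
def graph (k : StatementKind) : RootedDigraph ℕ where
  verts := Finset.range (k.lastVertex + 1)
  Adj := k.Edge
  source := 0
  source_mem := by simp
  left_mem := by
    intro a b h
    cases k <;> simp only [Edge, lastVertex, Finset.mem_range] at * <;> omega
  right_mem := by
    intro a b h
    cases k <;> simp only [Edge, lastVertex, Finset.mem_range] at * <;> omega

end StatementKind

namespace RootedDigraph

variable {V : Type u} [DecidableEq V]

/-- `G'` is obtained from `G` by expanding the vertex `a` into the graph `H`, whose sink is `t`:
`a` is replaced by a copy of `H` on vertices that do not occur elsewhere in `G`, the in-edges of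
`a` are led to the source of `H`, and the out-edges of `a` leave from `t`. (The name `a` itself
becomes free, so it may be reused in `H`.) -/
def IsExpansion (G : RootedDigraph V) (a : V) (H : RootedDigraph V) (t : V)
    (G' : RootedDigraph V) : Prop :=
  a ∈ G.verts ∧ Disjoint (G.verts \ {a}) H.verts ∧ H.IsSink t ∧
    G'.verts = (G.verts \ {a}) ∪ H.verts ∧
    G'.source = (if G.source = a then H.source else G.source) ∧
    ∀ x y, G'.Adj x y ↔
      (x ≠ a ∧ y ≠ a ∧ G.Adj x y) ∨ H.Adj x y ∨
        (x ≠ a ∧ G.Adj x a ∧ y = H.source) ∨ (x = t ∧ y ≠ a ∧ G.Adj a y)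

/-- Dijkstra graphs together with the set `X` of their expansible vertices; the other vertices
are regular. All vertices of a statement graph are expansible, but its source becomes regular
as soon as the graph is used (as a non-trivial one) in an expansion. -/
inductive IsLabeledDijkstra : RootedDigraph V → Finset V → Prop
  | trivial (G : RootedDigraph V) (hverts : G.verts = {G.source})
      (hadj : ∀ a b, ¬ G.Adj a b) : IsLabeledDijkstra G {G.source}
  | expand (G H G' : RootedDigraph V) (X : Finset V) (a t : V) (k : StatementKind)
      (hG : IsLabeledDijkstra G X) (ha : a ∈ X) (hk : k ≠ .trivial)
      (hH : ∃ f, IsIso k.graph H f) (hG' : IsExpansion G a H t G') :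
      IsLabeledDijkstra G' ((X \ {a}) ∪ (H.verts \ {H.source}))

/-- `G` is a Dijkstra graph. -/
def IsDijkstra (G : RootedDigraph V) : Prop := ∃ X, IsLabeledDijkstra G X

/-- `H` is an induced subgraph of `G` (with its own source). -/
def IsInducedSubgraph (H G : RootedDigraph V) : Prop :=
  H.verts ⊆ G.verts ∧ ∀ a b, H.Adj a b ↔ a ∈ H.verts ∧ b ∈ H.verts ∧ G.Adj a b

/-- `H` is a closed subgraph of `G`. -/
def IsClosedIn (H G : RootedDigraph V) : Prop :=
  ∃ t, H.IsSink t ∧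
    (∀ a ∈ H.verts, a ≠ H.source → ∀ b, G.Adj b a → b ∈ H.verts) ∧
    (∀ a ∈ H.verts, a ≠ t → ∀ b, G.Adj a b → b ∈ H.verts) ∧
    ∀ a, G.IsCycleEdge a H.source → G.Adj H.source a

/-- `H` is a prime subgraph of `G` of the kind `k`: an induced closed subgraph isomorphic to the
non-trivial statement graph `k`. The isomorphism respects the source and the cycle edges. -/
def IsPrimeIn (k : StatementKind) (H G : RootedDigraph V) : Prop :=
  k ≠ .trivial ∧ H.IsInducedSubgraph G ∧ H.IsClosedIn G ∧
    ∃ f, IsIso k.graph H f ∧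
      ∀ a b : k.graph.verts, k.graph.IsCycleEdge a b ↔ G.IsCycleEdge (f a) (f b)

/-- The image of a vertex under the contraction of `H`. -/
def contractVertex (H : RootedDigraph V) (a : V) : V := if a ∈ H.verts then H.source else a

/-- The contraction of `H` in `G`: the vertices of `H` are identified with the source of `H`,
and loops (and parallel edges) are removed. -/
def contract (G H : RootedDigraph V) : RootedDigraph V where
  verts := G.verts.image H.contractVertex
  Adj a b := a ≠ b ∧ ∃ x y, G.Adj x y ∧ H.contractVertex x = a ∧ H.contractVertex y = b
  source := H.contractVertex G.source
  source_mem := Finset.mem_image_of_mem _ G.source_mem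
  left_mem := by
    rintro a b ⟨-, x, y, h, rfl, -⟩
    exact Finset.mem_image_of_mem _ (G.left_mem h)
  right_mem := by
    rintro a b ⟨-, x, y, h, -, rfl⟩
    exact Finset.mem_image_of_mem _ (G.right_mem h)

end RootedDigraph

/-- The symbols of a code. A symbol `one a` is a `1` of the code, together with the vertex `a`
for which it was written (`C(a) := 1`); a symbol `kind n` is the type of a contracted prime
subgraph. -/
inductive CodeSymbol (V : Type u) where
  | one (a : V)
  | kind (n : ℕ)

/-- The integer shown by a symbol. -/
def CodeSymbol.toNat {V : Type u} : CodeSymbol V → ℕ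
  | .one _ => 1
  | .kind n => n

/-- The string of integers underlying a string of symbols. -/
def plainCode {V : Type u} (σ : List (CodeSymbol V)) : List ℕ := σ.map CodeSymbol.toNat

namespace RootedDigraph

variable {V : Type u}

/-- In the code of a prime subgraph `H` of the kind `k`, the codes of the vertices in this set
come first, directly after `type(H)`. -/
def firstPart (H : RootedDigraph V) : StatementKind → Set V
  | .trivial => ∅
  | .sequence => H.outNbr H.source
  | .ifThen => H.outNbr H.source \ H.outNbr2 H.source
  | .while => H.outNbr H.source ∩ H.inNbr H.source
  | .repeat => H.outNbr H.source
  | .ifThenElse => H.outNbr H.source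
  | .pCase _ _ => H.outNbr H.source

/-- In the code of a prime subgraph `H` of the kind `k`, the codes of the vertices in this set
come last. -/
def secondPart (H : RootedDigraph V) : StatementKind → Set V
  | .trivial => ∅
  | .sequence => ∅
  | .ifThen => H.outNbr2 H.source
  | .while => H.outNbr H.source \ H.inNbr H.source
  | .repeat => H.outNbr2 H.source \ {H.source}
  | .ifThenElse => H.outNbr2 H.source
  | .pCase _ _ => H.outNbr2 H.source

/-- `l` lists the elements of `S` in lexicographically non-decreasing order of their codes. -/
def IsLexListing (c : V → List (CodeSymbol V)) (S : Set V) (l : List V) : Prop :=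
  l.Nodup ∧ (∀ a, a ∈ l ↔ a ∈ S) ∧ l.Pairwise fun a b => plainCode (c a) ≤ plainCode (c b)

/-- `σ` is the code `C(H)` of the prime subgraph `H` of the kind `k`, where `c` gives the codes
of the vertices. -/
def IsPrimeCode (c : V → List (CodeSymbol V)) (k : StatementKind) (H : RootedDigraph V)
    (σ : List (CodeSymbol V)) : Prop :=
  ∃ l₁ l₂, IsLexListing c (H.firstPart k) l₁ ∧ IsLexListing c (H.secondPart k) l₂ ∧
    σ = CodeSymbol.kind k.typeNumber :: (l₁.flatMap c ++ l₂.flatMap c)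

variable [DecidableEq V]

/-- `CodingRun G c L c'`: processing the vertices of the list `L` in this order, starting with
the graph `G` and the vertex codes `c`, can end with the vertex codes `c'`. If the vertex that is
processed is the source of a prime subgraph `H` of the current graph, then `C(H)` is appended to
its code and `H` is contracted; otherwise nothing happens. -/
inductive CodingRun : RootedDigraph V → (V → List (CodeSymbol V)) → List V →
    (V → List (CodeSymbol V)) → Prop
  | done (G : RootedDigraph V) (c : V → List (CodeSymbol V)) : CodingRun G c [] c
  | skip (G : RootedDigraph V) (c c' : V → List (CodeSymbol V)) (a : V) (L : List V)
      (h : ¬ ∃ k H, IsPrimeIn k H G ∧ H.source = a) (hL : CodingRun G c L c') :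
      CodingRun G c (a :: L) c'
  | contract (G : RootedDigraph V) (c c' : V → List (CodeSymbol V)) (a : V) (L : List V)
      (k : StatementKind) (H : RootedDigraph V) (σ : List (CodeSymbol V))
      (hH : IsPrimeIn k H G) (ha : H.source = a) (hσ : IsPrimeCode c k H σ)
      (hL : CodingRun (G.contract H) (Function.update c a (c a ++ σ)) L c') :
      CodingRun G c (a :: L) c'

/-- `σ` is a code of `G` whose `1`s are annotated with the vertices they stand for: it is the
final code of the source of `G` after the vertices have been processed in the reverse of a
topological sort of `G` minus its cycle edges, all vertex codes being `1` initially. -/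
def IsAnnotatedCode (G : RootedDigraph V) (σ : List (CodeSymbol V)) : Prop :=
  ∃ L c, G.IsTopologicalSort L ∧ CodingRun G (fun a => [.one a]) L.reverse c ∧ σ = c G.source

/-- `C` is a code `C(G)` of `G`, a string of integers. -/
def IsCode (G : RootedDigraph V) (C : List ℕ) : Prop :=
  ∃ σ, G.IsAnnotatedCode σ ∧ plainCode σ = C

end RootedDigraph

/-! A Dijkstra graph is described by a tree. Each expansion grafts a one-level tree at a leaf, so
the leaves are the expansible vertices, and an internal node of kind `k` records a statement graph
whose vertices other than the source may have been expanded further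
(`exists_represents_of_isLabeledDijkstra`). The algorithm reads such a tree back from the bottom.

The preorder of the labels is a topological order for the forward edges, while a back edge lies in a
region that can be entered only at its head. Hence every path from the source meets the head of a
back edge no later than its tail, and the cycle edges of the graph are exactly those stemming from
cycle edges of statement graphs, whatever the search (`Represents.isCycleEdge_iff`).

Runs are controlled by local facts. A lowest internal node is the source of a prime subgraph
(`Represents.primeChart`), which is determined by its source (`PrimeChart.unique`), and contracting
it turns this node into a leaf (`Represents.contract`). A leaf is never the source of a prime
subgraph (`Represents.not_primeChart_of_isLeaf`). An internal node reaches all nodes below it by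
forward edges, so the reverse of any topological sort works bottom up. Every run therefore yields a
code of the tree: at each node a type, followed by the codes of the branches, sorted except for the
sink branch, which stays last (`Represents.codingRun`).

Ties in the sorting and the names of the vertices do not affect the integers (`IsTreeCode.unique`);
this gives uniqueness and the equality of codes of isomorphic graphs. Conversely, permuting the
branches other than the sink branch does not change the graph, so an annotated code is the preorder
reading of some tree that represents the graph (`Represents.exists_reorder`). Such a string can be
parsed, because a type is at least 2 and fixes the number of branches. Equal codes thus come from
trees of equal shape, and matching labels at equal positions is an isomorphism (`exists_pairing`,
`Represents.exists_iso`). -/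

namespace StatementKind

/-! ### Combinatorics of the statement graphs -/

/-- The edges of a statement graph that are not cycle edges. -/
def ForwardEdge (k : StatementKind) (i j : ℕ) : Prop := k.Edge i j ∧ i < j

/-- The cycle edges of a statement graph. -/
def BackEdge (k : StatementKind) (i j : ℕ) : Prop := k.Edge i j ∧ j < i

theorem edge_iff (k : StatementKind) (i j : ℕ) :
    k.Edge i j ↔ k.ForwardEdge i j ∨ k.BackEdge i j := by
  cases k <;> grind [ForwardEdge, BackEdge, Edge, lastVertex]

theorem Edge.le {k : StatementKind} {i j : ℕ} (h : k.Edge i j) :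
    i ≤ k.lastVertex ∧ j ≤ k.lastVertex := by
  cases k <;> grind [ForwardEdge, BackEdge, Edge, lastVertex]

theorem Edge.ne {k : StatementKind} {i j : ℕ} (h : k.Edge i j) : i ≠ j := by
  cases k <;> grind [ForwardEdge, BackEdge, Edge, lastVertex]

/-- Only while and repeat graphs have a cycle edge, from 1 to 0. The second conjunct supplies the
clause on cycle edges in the closedness of prime subgraphs. -/
theorem BackEdge.eq {k : StatementKind} {i j : ℕ} (h : k.BackEdge i j) :
    j = 0 ∧ k.Edge 0 i := by
  cases k <;> grind [ForwardEdge, BackEdge, Edge, lastVertex]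

theorem lastVertex_pos {k : StatementKind} (hk : k ≠ .trivial) : 0 < k.lastVertex := by
  cases k <;> simp_all [lastVertex]

theorem not_edge_lastVertex (k : StatementKind) (j : ℕ) : ¬ k.Edge k.lastVertex j := by
  cases k <;> grind [ForwardEdge, BackEdge, Edge, lastVertex]

theorem exists_forwardEdge_to {k : StatementKind} {j : ℕ} (hj : 0 < j) (hj' : j ≤ k.lastVertex) :
    ∃ i, k.ForwardEdge i j := by
  cases k
  · grind [lastVertex]
  · exact ⟨0, by grind [ForwardEdge, BackEdge, Edge, lastVertex]⟩
  · exact ⟨0, by grind [ForwardEdge, BackEdge, Edge, lastVertex]⟩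
  · exact ⟨0, by grind [ForwardEdge, BackEdge, Edge, lastVertex]⟩
  · exact ⟨j - 1, by grind [ForwardEdge, BackEdge, Edge, lastVertex]⟩
  · by_cases h : j = 3
    · exact ⟨1, by grind [ForwardEdge, BackEdge, Edge, lastVertex]⟩
    · exact ⟨0, by grind [ForwardEdge, BackEdge, Edge, lastVertex]⟩
  · rename_i p hp
    by_cases h : j = p + 1
    · exact ⟨1, by grind [ForwardEdge, BackEdge, Edge, lastVertex]⟩
    · exact ⟨0, by grind [ForwardEdge, BackEdge, Edge, lastVertex]⟩

theorem exists_edge_from {k : StatementKind} {i : ℕ} (hi : i < k.lastVertex) :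
    ∃ j, k.Edge i j := by
  cases k
  · grind [lastVertex]
  · exact ⟨1, by grind [ForwardEdge, BackEdge, Edge, lastVertex]⟩
  · exact ⟨2, by grind [ForwardEdge, BackEdge, Edge, lastVertex]⟩
  · exact ⟨1 - i, by grind [ForwardEdge, BackEdge, Edge, lastVertex]⟩
  · exact ⟨i + 1, by grind [ForwardEdge, BackEdge, Edge, lastVertex]⟩
  · by_cases h : i = 0
    · exact ⟨1, by grind [ForwardEdge, BackEdge, Edge, lastVertex]⟩
    · exact ⟨3, by grind [ForwardEdge, BackEdge, Edge, lastVertex]⟩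
  · rename_i p hp
    by_cases h : i = 0
    · exact ⟨1, by grind [ForwardEdge, BackEdge, Edge, lastVertex]⟩
    · exact ⟨p + 1, by grind [ForwardEdge, BackEdge, Edge, lastVertex]⟩

/-- An inner vertex of a statement graph is the tail of a cycle edge, or else its way to the sink
can be avoided. -/
theorem backEdge_or_bypass {k : StatementKind} {i : ℕ} (hi : 0 < i) (hi' : i < k.lastVertex) :
    (∃ j, k.BackEdge i j) ∨
      (k.ForwardEdge i k.lastVertex ∧
        ∃ j, j ≠ i ∧ k.ForwardEdge j k.lastVertex ∧ (j = 0 ∨ k.ForwardEdge 0 j)) := by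
  cases k
  · grind [lastVertex]
  · grind [lastVertex]
  · exact .inr ⟨by grind [ForwardEdge, BackEdge, Edge, lastVertex], 0,
      by grind [ForwardEdge, BackEdge, Edge, lastVertex]⟩
  · exact .inl ⟨0, by grind [ForwardEdge, BackEdge, Edge, lastVertex]⟩
  · exact .inl ⟨0, by grind [ForwardEdge, BackEdge, Edge, lastVertex]⟩
  · exact .inr ⟨by grind [ForwardEdge, BackEdge, Edge, lastVertex], 3 - i,
      by grind [ForwardEdge, BackEdge, Edge, lastVertex]⟩
  · rename_i p hp
    by_cases h : i = 1
    · exact .inr ⟨by grind [ForwardEdge, BackEdge, Edge, lastVertex], 2,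
        by grind [ForwardEdge, BackEdge, Edge, lastVertex]⟩
    · exact .inr ⟨by grind [ForwardEdge, BackEdge, Edge, lastVertex], 1,
        by grind [ForwardEdge, BackEdge, Edge, lastVertex]⟩

theorem edge_zero_one {k : StatementKind} (hk : k ≠ .trivial) : k.Edge 0 1 := by
  cases k <;> grind [ForwardEdge, BackEdge, Edge, lastVertex]

theorem two_le_typeNumber {k : StatementKind} (hk : k ≠ .trivial) : 2 ≤ k.typeNumber := by
  cases k <;> simp [typeNumber] at *

theorem typeNumber_injective : Function.Injective typeNumber := by
  intro k k' h
  cases k <;> cases k' <;> simp [typeNumber] at * <;> omega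

end StatementKind

/-! ### Statement trees and the graphs they describe -/

/-- The statement trees describe how Dijkstra graphs are built up: `node k hk a ch` stands for a
statement graph of the kind `k` with the source `a` whose other vertices have been expanded into
the graphs described by the trees `ch i`. -/
inductive StatementTree (V : Type u) where
  | leaf (a : V)
  | node (k : StatementKind) (hk : k ≠ .trivial) (a : V)
      (ch : Fin k.lastVertex → StatementTree V)

namespace StatementTree

variable {V : Type u} {W : Type v}

/-- The vertex `a` together with a family of further vertices. -/
def slot {m : ℕ} (a : V) (f : Fin m → V) : Fin (m + 1) → V := Fin.cons a f

@[simp] theorem slot_zero {m : ℕ} (a : V) (f : Fin m → V) : slot a f 0 = a := rfl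

@[simp] theorem slot_succ {m : ℕ} (a : V) (f : Fin m → V) (i : Fin m) :
    slot a f i.succ = f i := rfl

theorem apply_slot {m : ℕ} (g : V → W) (a : V) (f : Fin m → V) (i : Fin (m + 1)) :
    g (slot a f i) = slot (g a) (fun j => g (f j)) i := by
  cases i using Fin.cases <;> rfl

/-- The source of the graph described by a tree. -/
def root : StatementTree V → V
  | leaf a => a
  | node _ _ a _ => a

/-- The sink of the graph described by a tree. -/
def sink : StatementTree V → V
  | leaf a => a
  | node k _ a ch => slot a (fun i => (ch i).sink) (Fin.last k.lastVertex)

/-- The vertices of the graph described by a tree. -/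
def labels : StatementTree V → List V
  | leaf a => [a]
  | node _ _ a ch => a :: (List.ofFn fun i => (ch i).labels).flatten

/-- The edges of the graph described by a tree that stem from those edges of the statement graphs
that are described by `E`. -/
def Rel (E : StatementKind → ℕ → ℕ → Prop) : StatementTree V → V → V → Prop
  | leaf _, _, _ => False
  | node k _ a ch, x, y => (∃ i, Rel E (ch i) x y) ∨
      ∃ i j : Fin (k.lastVertex + 1), E k i j ∧
        x = slot a (fun i => (ch i).sink) i ∧ y = slot a (fun i => (ch i).root) j

/-- The edges of the graph described by a tree. -/
abbrev Adj : StatementTree V → V → V → Prop := Rel StatementKind.Edge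

/-- The edges that are not cycle edges. -/
abbrev Forward : StatementTree V → V → V → Prop := Rel StatementKind.ForwardEdge

/-- The cycle edges. -/
abbrev Back : StatementTree V → V → V → Prop := Rel StatementKind.BackEdge

/-- The leaves play the role of the expansible vertices, the internal labels that of the regular
ones. -/
def IsLeaf : StatementTree V → V → Prop
  | leaf a, x => x = a
  | node _ _ _ ch, x => ∃ i, (ch i).IsLeaf x

def IsInternal : StatementTree V → V → Prop
  | leaf _, _ => False
  | node _ _ a ch, x => x = a ∨ ∃ i, (ch i).IsInternal x

/-- The node labelled `y` is internal and lies properly below the node labelled `x`. -/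
def Above : StatementTree V → V → V → Prop
  | leaf _, _, _ => False
  | node _ _ a ch, x, y => (x = a ∧ ∃ i, (ch i).IsInternal y) ∨ ∃ i, (ch i).Above x y

/-- Replace the leaves labelled `a` by the tree `S`. -/
def graft [DecidableEq V] : StatementTree V → V → StatementTree V → StatementTree V
  | leaf x, a, S => if x = a then S else leaf x
  | node k hk x ch, a, S => node k hk x fun i => (ch i).graft a S

/-- Relabel the nodes. -/
def map (g : V → W) : StatementTree V → StatementTree W
  | leaf a => leaf (g a)
  | node k hk a ch => node k hk (g a) fun i => (ch i).map g

@[simp] theorem mem_labels_leaf {a x : V} : x ∈ (leaf a).labels ↔ x = a := by simp [labels]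

@[simp] theorem mem_labels_node {k : StatementKind} {hk : k ≠ .trivial} {a x : V}
    {ch : Fin k.lastVertex → StatementTree V} :
    x ∈ (node k hk a ch).labels ↔ x = a ∨ ∃ i, x ∈ (ch i).labels := by
  simp [labels, List.mem_ofFn]

theorem nodup_labels_node {k : StatementKind} {hk : k ≠ .trivial} {a : V}
    {ch : Fin k.lastVertex → StatementTree V} :
    (node k hk a ch).labels.Nodup ↔ (∀ i, a ∉ (ch i).labels) ∧ (∀ i, (ch i).labels.Nodup) ∧
      ∀ i j x, x ∈ (ch i).labels → x ∈ (ch j).labels → i = j := by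
  simp only [labels, List.nodup_cons, List.mem_flatten, List.mem_ofFn, List.nodup_flatten,
    List.pairwise_ofFn]
  constructor
  · rintro ⟨h1, h2, h3⟩
    refine ⟨fun i hi => h1 ⟨_, ⟨i, rfl⟩, hi⟩, fun i => h2 _ ⟨i, rfl⟩, fun i j x hi hj => ?_⟩
    rcases lt_trichotomy i j with h | h | h
    · exact (h3 h hi hj).elim
    · exact h
    · exact (h3 h hj hi).elim
  · rintro ⟨h1, h2, h3⟩
    refine ⟨?_, ?_, fun i j hij x hi hj => hij.ne (h3 i j x hi hj)⟩
    · rintro ⟨_, ⟨i, rfl⟩, hi⟩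
      exact h1 i hi
    · rintro _ ⟨i, rfl⟩
      exact h2 i

theorem root_mem : ∀ T : StatementTree V, T.root ∈ T.labels
  | leaf _ => by simp [root]
  | node .. => by simp [root]

theorem sink_mem : ∀ T : StatementTree V, T.sink ∈ T.labels
  | leaf _ => by simp [sink]
  | node k hk a ch => by
    rw [sink]
    generalize Fin.last k.lastVertex = i
    cases i using Fin.cases with
    | zero => simp
    | succ i => simpa using .inr ⟨i, sink_mem (ch i)⟩

theorem slot_root_mem {k : StatementKind} (hk : k ≠ .trivial) (a : V)
    (ch : Fin k.lastVertex → StatementTree V) (i : Fin (k.lastVertex + 1)) :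
    slot a (fun i => (ch i).root) i ∈ (node k hk a ch).labels := by
  cases i using Fin.cases with
  | zero => simp
  | succ i => simpa using .inr ⟨i, root_mem (ch i)⟩

theorem slot_sink_mem {k : StatementKind} (hk : k ≠ .trivial) (a : V)
    (ch : Fin k.lastVertex → StatementTree V) (i : Fin (k.lastVertex + 1)) :
    slot a (fun i => (ch i).sink) i ∈ (node k hk a ch).labels := by
  cases i using Fin.cases with
  | zero => simp
  | succ i => simpa using .inr ⟨i, sink_mem (ch i)⟩

theorem Rel.mem {E : StatementKind → ℕ → ℕ → Prop} : ∀ {T : StatementTree V} {x y : V},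
    T.Rel E x y → x ∈ T.labels ∧ y ∈ T.labels
  | leaf _, _, _, h => h.elim
  | node k hk a ch, x, y, h => by
    rcases h with ⟨i, h⟩ | ⟨i, j, -, rfl, rfl⟩
    · simp only [mem_labels_node]
      exact ⟨.inr ⟨i, (Rel.mem h).1⟩, .inr ⟨i, (Rel.mem h).2⟩⟩
    · exact ⟨slot_sink_mem hk a ch i, slot_root_mem hk a ch j⟩

theorem adj_iff : ∀ {T : StatementTree V} {x y : V}, T.Adj x y ↔ T.Forward x y ∨ T.Back x y
  | leaf _, _, _ => by simp [Rel]
  | node k hk a ch, x, y => by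
    have ih := fun i => adj_iff (T := ch i) (x := x) (y := y)
    simp only [Adj, Forward, Back, Rel, StatementKind.edge_iff, or_and_right, exists_or] at ih ⊢
    simp only [ih, exists_or]
    exact or_or_or_comm

theorem IsLeaf.mem : ∀ {T : StatementTree V} {x : V}, T.IsLeaf x → x ∈ T.labels
  | leaf _, _, h => mem_labels_leaf.2 h
  | node _ _ _ _, _, ⟨i, h⟩ => by simpa using .inr ⟨i, IsLeaf.mem h⟩

theorem IsInternal.mem : ∀ {T : StatementTree V} {x : V}, T.IsInternal x → x ∈ T.labels
  | leaf _, _, h => h.elim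
  | node _ _ _ _, _, .inl h => by simp [h]
  | node _ _ _ _, _, .inr ⟨i, h⟩ => by simpa using .inr ⟨i, IsInternal.mem h⟩

theorem isLeaf_or_isInternal : ∀ {T : StatementTree V} {x : V}, x ∈ T.labels →
    T.IsLeaf x ∨ T.IsInternal x
  | leaf _, _, h => (.inl (mem_labels_leaf.1 h))
  | node _ _ _ _, _, h => by
    rcases mem_labels_node.1 h with h | ⟨i, h⟩
    · exact .inr (.inl h)
    · exact (isLeaf_or_isInternal h).imp (fun h => ⟨i, h⟩) fun h => .inr ⟨i, h⟩

theorem IsLeaf.not_isInternal : ∀ {T : StatementTree V} {x : V}, T.labels.Nodup → T.IsLeaf x →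
    ¬ T.IsInternal x
  | leaf _, _, _, _, h => h
  | node _ _ a ch, x, hn, ⟨i, h⟩, h' => by
    obtain ⟨h1, h2, h3⟩ := nodup_labels_node.1 hn
    rcases h' with rfl | ⟨j, h'⟩
    · exact h1 i h.mem
    · obtain rfl := h3 i j x h.mem h'.mem
      exact IsLeaf.not_isInternal (h2 i) h h'

theorem Above.isInternal : ∀ {T : StatementTree V} {x y : V}, T.Above x y →
    T.IsInternal x ∧ T.IsInternal y
  | leaf _, _, _, h => h.elim
  | node _ _ _ _, _, _, .inl ⟨h, h'⟩ => ⟨.inl h, .inr h'⟩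
  | node _ _ _ _, _, _, .inr ⟨i, h⟩ => ⟨.inr ⟨i, h.isInternal.1⟩, .inr ⟨i, h.isInternal.2⟩⟩

/-! ### Grafting, the tree form of expansion -/

section Graft

variable [DecidableEq V] {a : V} {S : StatementTree V}

/-- Grafting replaces leaves only; the hypothesis ensures that no label `a` survives at an internal
node. -/
theorem root_graft : ∀ {T : StatementTree V}, ¬ T.IsInternal a →
    (T.graft a S).root = if T.root = a then S.root else T.root
  | leaf x, _ => by
    by_cases h : x = a <;> simp [graft, root, h]
  | node k hk x ch, h => by
    have : x ≠ a := fun hx => h (.inl hx.symm)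
    simp [graft, root, this]

theorem sink_graft : ∀ {T : StatementTree V}, ¬ T.IsInternal a →
    (T.graft a S).sink = if T.sink = a then S.sink else T.sink
  | leaf x, _ => by
    by_cases h : x = a <;> simp [graft, sink, h]
  | node k hk x ch, h => by
    have hx : x ≠ a := fun hx => h (.inl hx.symm)
    have hs : ∀ i, slot x (fun i => ((ch i).graft a S).sink) i =
        if slot x (fun i => (ch i).sink) i = a then S.sink else
          slot x (fun i => (ch i).sink) i := by
      intro i
      cases i using Fin.cases with
      | zero => simp [hx]
      | succ i => exact sink_graft fun h' => h (.inr ⟨i, h'⟩)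
    exact hs _

theorem labels_graft : ∀ {T : StatementTree V}, ¬ T.IsInternal a →
    (T.graft a S).labels = T.labels.flatMap fun x => if x = a then S.labels else [x]
  | leaf x, _ => by
    by_cases h : x = a <;> simp [graft, labels, h]
  | node k hk x ch, h => by
    have hx : x ≠ a := fun hx => h (.inl hx.symm)
    have ih : ∀ i, ((ch i).graft a S).labels = _ := fun i =>
      labels_graft fun h' => h (.inr ⟨i, h'⟩)
    simp only [graft, labels, ih, List.flatMap_cons, hx, if_false, List.singleton_append]
    rw [← List.flatMap_id, ← List.flatMap_id, List.flatMap_assoc, List.flatMap_def,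
      List.flatMap_def, List.map_ofFn, List.map_ofFn]
    rfl

theorem mem_labels_graft {T : StatementTree V} (h : ¬ T.IsInternal a) {x : V} :
    x ∈ (T.graft a S).labels ↔ (x ∈ T.labels ∧ x ≠ a) ∨ (a ∈ T.labels ∧ x ∈ S.labels) := by
  rw [labels_graft h, List.mem_flatMap]
  constructor
  · rintro ⟨y, hy, hx⟩
    split_ifs at hx with h
    · exact .inr ⟨h ▸ hy, hx⟩
    · obtain rfl := List.mem_singleton.1 hx
      exact .inl ⟨hy, h⟩
  · rintro (⟨h1, h2⟩ | ⟨h1, h2⟩)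
    · exact ⟨x, h1, by simp [h2]⟩
    · exact ⟨a, h1, by simpa using h2⟩

theorem nodup_labels_graft {T : StatementTree V} (h : T.IsLeaf a) (h' : ¬ T.IsInternal a) :
    (T.graft a S).labels.Nodup ↔ T.labels.Nodup ∧ S.labels.Nodup ∧
      ∀ x ∈ T.labels, x ≠ a → x ∉ S.labels := by
  rw [labels_graft h', List.nodup_flatMap]
  constructor
  · rintro ⟨h1, h2⟩
    have hn : T.labels.Nodup := h2.imp fun {x y} hxy => by
      rintro rfl
      by_cases hx : x = a
      · simp only [Function.onFun, hx, if_true] at hxy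
        exact hxy S.root_mem S.root_mem
      · simp [Function.onFun, hx] at hxy
    refine ⟨hn, by simpa using h1 a h.mem, fun x hx hxa hxS => ?_⟩
    have : Std.Symm (Function.onFun List.Disjoint fun x => if x = a then S.labels else [x]) :=
      ⟨fun _ _ h => h.symm⟩
    have := h2.forall hx h.mem hxa
    simp [Function.onFun, hxa] at this
    exact this hxS
  · rintro ⟨h1, h2, h3⟩
    refine ⟨fun x _ => by split_ifs <;> simp [h2], ?_⟩
    refine List.Pairwise.imp_of_mem ?_ h1
    intro x y hx hy hxy
    simp only [Function.onFun]
    split_ifs with hxa hya hya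
    · exact (hxy (hxa.trans hya.symm)).elim
    · simpa using h3 y hy hya
    · simpa using h3 x hx hxa
    · simpa using Ne.symm hxy

/-- Every old edge survives, with a tail `a` moved to the sink of `S` and a head `a` moved to its
root. This is the rule for edges in an expansion, valid for forward and back edges separately. -/
theorem rel_graft {E : StatementKind → ℕ → ℕ → Prop} : ∀ {T : StatementTree V} {x y : V},
    ¬ T.IsInternal a → ((T.graft a S).Rel E x y ↔ (T.IsLeaf a ∧ S.Rel E x y) ∨
      ∃ x₀ y₀, T.Rel E x₀ y₀ ∧ x = (if x₀ = a then S.sink else x₀) ∧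
        y = if y₀ = a then S.root else y₀)
  | leaf z, x, y, _ => by
    by_cases h : z = a
    · simp [graft, IsLeaf, Rel, h]
    · simp [graft, IsLeaf, Rel, h, Ne.symm h]
  | node k hk z ch, x, y, h => by
    have hz : z ≠ a := fun hz => h (.inl hz.symm)
    have hc : ∀ i, ¬ (ch i).IsInternal a := fun i h' => h (.inr ⟨i, h'⟩)
    have ih := fun i => rel_graft (E := E) (T := ch i) (x := x) (y := y) (hc i)
    have hs : ∀ i, slot z (fun i => ((ch i).graft a S).sink) i =
        if slot z (fun i => (ch i).sink) i = a then S.sink else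
          slot z (fun i => (ch i).sink) i := by
      intro i
      cases i using Fin.cases with
      | zero => simp [hz]
      | succ i => exact sink_graft (hc i)
    have hr : ∀ i, slot z (fun i => ((ch i).graft a S).root) i =
        if slot z (fun i => (ch i).root) i = a then S.root else
          slot z (fun i => (ch i).root) i := by
      intro i
      cases i using Fin.cases with
      | zero => simp [hz]
      | succ i => exact root_graft (hc i)
    simp only [graft, Rel, ih, IsLeaf, hs, hr]
    constructor
    · rintro (⟨i, ⟨h1, h2⟩ | ⟨x₀, y₀, h1, h2⟩⟩ | ⟨i, j, h1, h2⟩)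
      · exact .inl ⟨⟨i, h1⟩, h2⟩
      · exact .inr ⟨x₀, y₀, .inl ⟨i, h1⟩, h2⟩
      · exact .inr ⟨_, _, .inr ⟨i, j, h1, rfl, rfl⟩, h2⟩
    · rintro (⟨⟨i, h1⟩, h2⟩ | ⟨x₀, y₀, ⟨i, h1⟩ | ⟨i, j, h1, rfl, rfl⟩, h2⟩)
      · exact .inl ⟨i, .inl ⟨h1, h2⟩⟩
      · exact .inl ⟨i, .inr ⟨x₀, y₀, h1, h2⟩⟩
      · exact .inr ⟨i, j, h1, h2⟩

theorem isLeaf_graft : ∀ {T : StatementTree V} {x : V},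
    (T.graft a S).IsLeaf x ↔ (T.IsLeaf x ∧ x ≠ a) ∨ (T.IsLeaf a ∧ S.IsLeaf x)
  | leaf z, x => by
    by_cases h : z = a
    · simp [graft, IsLeaf, h]
    · simp only [graft, h, IsLeaf, if_false, Ne.symm h, false_and, or_false]
      exact ⟨fun hx => ⟨hx, hx ▸ h⟩, fun hx => hx.1⟩
  | node k hk z ch, x => by
    simp only [graft, IsLeaf, isLeaf_graft (T := ch _)]
    rw [exists_or, exists_and_right, exists_and_right]

theorem IsInternal.graft : ∀ {T : StatementTree V} {x : V}, T.IsInternal x →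
    (T.graft a S).IsInternal x
  | leaf _, _, h => h.elim
  | node _ _ _ _, _, .inl h => .inl h
  | node _ _ _ _, _, .inr ⟨i, h⟩ => .inr ⟨i, IsInternal.graft h⟩

theorem Above.graft : ∀ {T : StatementTree V} {x y : V}, T.Above x y → (T.graft a S).Above x y
  | leaf _, _, _, h => h.elim
  | node _ _ _ _, _, _, .inl ⟨h, i, h'⟩ => .inl ⟨h, i, h'.graft⟩
  | node _ _ _ _, _, _, .inr ⟨i, h⟩ => .inr ⟨i, Above.graft h⟩

theorem graft_of_notMem : ∀ {T : StatementTree V}, a ∉ T.labels → T.graft a S = T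
  | leaf x, h => by
    have : x ≠ a := fun hx => h (by simp [hx])
    simp [StatementTree.graft, this]
  | node k hk x ch, h => by
    simp only [mem_labels_node, not_or, not_exists] at h
    simp only [StatementTree.graft, graft_of_notMem (h.2 _)]

/-- A tree can be cut at every internal node. -/
theorem exists_eq_graft : ∀ {T : StatementTree V}, T.labels.Nodup → T.IsInternal a →
    ∃ (T' : StatementTree V) (k : StatementKind) (hk : k ≠ .trivial)
      (ch : Fin k.lastVertex → StatementTree V), T = T'.graft a (node k hk a ch) ∧ T'.IsLeaf a ∧ ¬ T'.IsInternal a ∧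
      ∀ i x, (ch i).IsInternal x → T.Above a x
  | leaf _, _, h => h.elim
  | node k hk z ch, hn, h => by
    obtain ⟨h1, h2, h3⟩ := nodup_labels_node.1 hn
    by_cases hz : a = z
    · subst hz
      exact ⟨leaf a, k, hk, ch, by simp [StatementTree.graft], rfl, fun h => h,
        fun i x hx => .inl ⟨rfl, i, hx⟩⟩
    · obtain ⟨i, hi⟩ : ∃ i, (ch i).IsInternal a := h.resolve_left hz
      obtain ⟨T', k', hk', ch', e, hl, hi', hA⟩ := exists_eq_graft (h2 i) hi
      -- Labels are distinct, so `a` occurs in the branch `i` alone and grafting leaves the other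
      -- branches untouched.
      refine ⟨node k hk z (Function.update ch i T'), k', hk', ch', ?_, ⟨i, by simpa using hl⟩, ?_,
        fun j x hx => .inr ⟨i, hA j x hx⟩⟩
      · simp only [StatementTree.graft]
        congr 1
        funext j
        by_cases hj : j = i
        · subst hj
          simpa using e
        · rw [Function.update_of_ne hj, graft_of_notMem fun h' => hj (h3 j i a h' hi.mem)]
      · rintro (h' | ⟨j, h'⟩)
        · exact hz h'
        · by_cases hj : j = i
          · subst hj
            exact hi' (by simpa using h')
          · rw [Function.update_of_ne hj] at h'
            exact hj (h3 j i a h'.mem hi.mem)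

end Graft

end StatementTree

/-! ### Topological order, cycle edges and depth-first search -/

open scoped List

namespace List

variable {α : Type u} [DecidableEq α]

theorem Nodup.idxOf_lt_idxOf {l : List α} (hl : l.Nodup) {x y : α} (h : [x, y] <+ l) :
    l.idxOf x < l.idxOf y := by
  obtain ⟨r₁, r₂, rfl, hx, h⟩ := List.cons_sublist_iff.1 h
  have hy : y ∉ r₁ := fun h' => (List.nodup_append.1 hl).2.2 y h' y (by simpa using h) rfl
  rw [List.idxOf_append_of_mem hx, List.idxOf_append_of_notMem hy]
  have := List.idxOf_lt_length_of_mem hx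
  omega

end List

namespace StatementTree

variable {V : Type u}

theorem adj_of_forward {T : StatementTree V} {x y : V} (h : T.Forward x y) : T.Adj x y :=
  adj_iff.2 (.inl h)

theorem adj_of_back {T : StatementTree V} {x y : V} (h : T.Back x y) : T.Adj x y :=
  adj_iff.2 (.inr h)

theorem sublist_flatten_ofFn {m : ℕ} (f : Fin m → List V) (i : Fin m) :
    f i <+ (List.ofFn f).flatten :=
  List.sublist_flatten_of_mem (List.mem_ofFn.2 ⟨i, rfl⟩)

theorem pair_sublist_flatten_ofFn : ∀ {m : ℕ} (f : Fin m → List V) {i j : Fin m} {x y : V},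
    i < j → x ∈ f i → y ∈ f j → [x, y] <+ (List.ofFn f).flatten
  | 0, _, i, _, _, _, _, _, _ => i.elim0
  | m + 1, f, i, j, x, y, hij, hx, hy => by
    rw [List.ofFn_succ, List.flatten_cons]
    cases j using Fin.cases with
    | zero => exact absurd hij (Fin.not_lt_zero i)
    | succ j =>
      cases i using Fin.cases with
      | zero =>
        exact (List.singleton_sublist.2 hx).append (List.singleton_sublist.2
          ((sublist_flatten_ofFn (fun i => f i.succ) j).subset hy))
      | succ i =>
        exact (pair_sublist_flatten_ofFn (fun i => f i.succ) (Fin.succ_lt_succ_iff.1 hij) hx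
          hy).trans (List.sublist_append_right _ _)

/-- The vertices are listed in a topological order. -/
theorem Rel.sublist_labels : ∀ {T : StatementTree V} {x y : V}, T.Forward x y →
    [x, y] <+ T.labels
  | leaf _, _, _, h => h.elim
  | node k hk a ch, x, y, h => by
    rw [labels]
    rcases h with ⟨i, h⟩ | ⟨i, j, ⟨-, hij⟩, rfl, rfl⟩
    · exact ((Rel.sublist_labels h).trans
        (sublist_flatten_ofFn (fun i => (ch i).labels) i)).cons _
    · cases j using Fin.cases with
      | zero => exact absurd hij (Fin.not_lt_zero i)
      | succ j =>
        cases i using Fin.cases with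
        | zero =>
          exact .cons_cons _ (List.singleton_sublist.2
            ((sublist_flatten_ofFn (fun i => (ch i).labels) j).subset (root_mem _)))
        | succ i =>
          exact .cons _ (pair_sublist_flatten_ofFn (fun i => (ch i).labels)
            (Fin.succ_lt_succ_iff.1 hij) (sink_mem _) (root_mem _))

theorem labels_eq_cons (T : StatementTree V) : ∃ l, T.labels = T.root :: l := by
  cases T with
  | leaf a => exact ⟨[], rfl⟩
  | node k hk a ch => exact ⟨_, rfl⟩

/-- The graph minus its cycle edges has no edge into the source. -/
theorem not_forward_root {T : StatementTree V} (hn : T.labels.Nodup) (x : V) :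
    ¬ T.Forward x T.root := by
  intro h
  obtain ⟨l, hl⟩ := labels_eq_cons T
  classical
  have := hn.idxOf_lt_idxOf h.sublist_labels
  simp [hl] at this

/-- A cycle edge `xy` lies in a part of the graph that can be entered at `y` only. -/
theorem Rel.exists_region : ∀ {T : StatementTree V} {x y : V}, T.labels.Nodup → T.Back x y →
    ∃ S : Set V, x ∈ S ∧ S ⊆ {z | z ∈ T.labels} ∧ (T.root ∈ S → T.root = y) ∧
      ∀ a b, T.Adj a b → a ∉ S → b ∈ S → b = y
  | leaf _, _, _, _, h => h.elim
  | node k hk v ch, x, y, hn, h => by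
    obtain ⟨h1, h2, h3⟩ := nodup_labels_node.1 hn
    rcases h with ⟨i, h⟩ | ⟨i, j, hij, rfl, rfl⟩
    -- The region found in a branch still works in the whole graph: edges from outside enter the
    -- branch at its root only, and the root lies in `S` only if it is `y`.
    · obtain ⟨S, hx, hS, hr, hS'⟩ := Rel.exists_region (h2 i) h
      refine ⟨S, hx, fun z hz => mem_labels_node.2 (.inr ⟨i, hS hz⟩),
        fun hv => absurd (hS hv) (h1 i), ?_⟩
      rintro a b (⟨j, hab⟩ | ⟨j, l, -, rfl, rfl⟩) ha hb
      · obtain rfl := h3 i j b (hS hb) hab.mem.2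
        exact hS' a b hab ha hb
      · cases l using Fin.cases with
        | zero => exact absurd (hS hb) (h1 i)
        | succ l =>
          simp only [slot_succ] at hb ⊢
          obtain rfl := h3 i l _ (hS hb) (root_mem _)
          exact hr hb
    -- A cycle edge of the top statement graph leads to the overall source, and the region is the
    -- whole vertex set.
    · refine ⟨{z | z ∈ (node k hk v ch).labels}, slot_sink_mem hk v ch i, subset_rfl, fun _ => ?_,
        fun a b hab ha => absurd hab.mem.1 ha⟩
      have : j = 0 := Fin.ext hij.eq.1
      simp [this, root]

theorem forward_trans_of_child {k : StatementKind} {hk : k ≠ .trivial} {v : V}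
    {ch : Fin k.lastVertex → StatementTree V} {i : Fin k.lastVertex} {x y : V}
    (h : Relation.ReflTransGen (ch i).Forward x y) :
    Relation.ReflTransGen (node k hk v ch).Forward x y :=
  Relation.ReflTransGen.mono (fun _ _ h => .inl ⟨i, h⟩) _ _ h

/-- Every vertex can be reached from the source. -/
theorem reachable : ∀ {T : StatementTree V} {x : V}, x ∈ T.labels →
    Relation.ReflTransGen T.Forward T.root x
  | leaf _, x, h => by
    obtain rfl := mem_labels_leaf.1 h
    exact .refl
  | node k hk v ch, x, h => by
    -- Induction on the slot number: a forward edge into slot `n` starts at the sink of a smaller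
    -- slot, which is reached through the root of that slot.
    have key : ∀ (n : ℕ) (hn : n < k.lastVertex + 1),
        Relation.ReflTransGen (node k hk v ch).Forward v
          (slot v (fun i => (ch i).root) ⟨n, hn⟩) := by
      intro n
      induction n using Nat.strong_induction_on with
      | _ n ih =>
        intro hn
        rcases Nat.eq_zero_or_pos n with rfl | hn0
        · exact .refl
        · obtain ⟨i, hi⟩ := StatementKind.exists_forwardEdge_to (k := k) hn0 (by omega)
          have hil : i < k.lastVertex + 1 := by have := hi.1.le; omega
          refine .tail (b := slot v (fun i => (ch i).sink) ⟨i, hil⟩) ?_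
            (.inr ⟨⟨i, hil⟩, ⟨n, hn⟩, hi, rfl, rfl⟩)
          refine (ih i hi.2 hil).trans ?_
          generalize (⟨i, hil⟩ : Fin (k.lastVertex + 1)) = i'
          cases i' using Fin.cases with
          | zero => exact .refl
          | succ i' => exact forward_trans_of_child (reachable (sink_mem (ch i')))
    rcases mem_labels_node.1 h with rfl | ⟨i, hi⟩
    · exact .refl
    · exact (key _ i.succ.2).trans (forward_trans_of_child (reachable hi))

/-- The graph `G` is described by the tree `T`. -/
structure Represents (T : StatementTree V) (G : RootedDigraph V) : Prop where
  nodup : T.labels.Nodup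
  source : G.source = T.root
  mem_verts : ∀ x, x ∈ G.verts ↔ x ∈ T.labels
  adj : ∀ x y, G.Adj x y ↔ T.Adj x y

section Rank

variable [DecidableEq V]

/-- The position of a vertex in the topological order. -/
def rank (T : StatementTree V) (x : V) : ℕ := T.labels.idxOf x

theorem rank_lt {T : StatementTree V} (hn : T.labels.Nodup) {x y : V} (h : T.Forward x y) :
    T.rank x < T.rank y :=
  hn.idxOf_lt_idxOf h.sublist_labels

end Rank

/-- A cycle edge does not occur in a path without repetitions from the source. -/
theorem mem_of_isChain {T : StatementTree V} (hn : T.labels.Nodup) {x y : V} (h : T.Back x y)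
    {stack : List V} (hc : (x :: stack).IsChain fun b a => T.Adj a b)
    (hl : (x :: stack).getLast? = some T.root) : y ∈ x :: stack := by
  obtain ⟨S, hx, -, hr, hS⟩ := Rel.exists_region hn h
  -- Only the membership of the current vertex in `S` matters from here on. Going down the path,
  -- either it stays in `S` as far as the root, which is then `y`, or it crosses into `S` by an edge
  -- whose head is `y`.
  clear h
  induction stack generalizing x with
  | nil =>
    have : x = T.root := by simpa using hl
    subst this
    simp [hr hx]
  | cons a stack ih =>
    rw [List.isChain_cons_cons] at hc
    by_cases ha : a ∈ S
    · exact List.mem_cons_of_mem _ (ih hc.2 (by simpa using hl) ha)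
    · simp [hS a x hc.1 ha hx]

/-- A back edge is never used for a push, since its head is already on the stack and hence visited.
So the stack of any search is a forward path from the root. -/
theorem Represents.stack {T : StatementTree V} {G : RootedDigraph V} (hT : T.Represents G)
    {stack : List V} {visited : Set V} (h : G.DFSState stack visited) :
    stack.IsChain (fun b a => T.Forward a b) ∧ (∀ a ∈ stack, a ∈ visited) ∧
      (stack ≠ [] → stack.getLast? = some T.root) := by
  induction h with
  | start => simp [hT.source]
  | @push a b stack visited _ hab hb ih =>
    obtain ⟨h1, h2, h3⟩ := ih
    refine ⟨List.isChain_cons_cons.2 ⟨?_, h1⟩, ?_, fun _ => by simpa using h3 (by simp)⟩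
    · refine (adj_iff.1 ((hT.adj a b).1 hab)).resolve_right fun hB => hb (h2 b ?_)
      exact mem_of_isChain hT.nodup hB (h1.imp fun _ _ h => adj_of_forward h) (h3 (by simp))
    · intro x hx
      rcases List.mem_cons.1 hx with rfl | hx
      · exact Set.mem_insert _ _
      · exact Set.mem_insert_of_mem _ (h2 x hx)
  | @pop a stack visited _ _ ih =>
    obtain ⟨h1, h2, h3⟩ := ih
    refine ⟨h1.tail, fun x hx => h2 x (List.mem_cons_of_mem _ hx), fun hs => ?_⟩
    obtain ⟨b, l, rfl⟩ := List.exists_cons_of_ne_nil hs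
    simpa using h3 (by simp)

/-- The search follows a forward path without popping; ranks increase along it, so the next vertex
is always unvisited. -/
theorem Represents.exists_stack [DecidableEq V] {T : StatementTree V} {G : RootedDigraph V}
    (hT : T.Represents G) {x : V} (hx : Relation.ReflTransGen T.Forward T.root x) :
    ∃ stack, G.DFSState (x :: stack) {z | z ∈ x :: stack} ∧
      ∀ z ∈ stack, T.rank z < T.rank x := by
  induction hx with
  | refl =>
    refine ⟨[], ?_, by simp⟩
    convert RootedDigraph.DFSState.start (G := G) using 1
    · rw [hT.source]
    · ext z
      simp [hT.source]
  | @tail a b _ hab ih =>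
    obtain ⟨stack, h1, h2⟩ := ih
    have hr := rank_lt hT.nodup hab
    refine ⟨a :: stack, ?_, ?_⟩
    · convert h1.push ((hT.adj a b).2 (adj_of_forward hab)) ?_ using 1
      · ext z
        simp
      · intro hb
        rcases List.mem_cons.1 hb with rfl | hb
        · exact hr.false
        · exact (h2 b hb).not_gt hr
    · intro z hz
      rcases List.mem_cons.1 hz with rfl | hz
      · exact hr
      · exact (h2 z hz).trans hr

theorem isChain_rank [DecidableEq V] {T : StatementTree V} (hn : T.labels.Nodup) {x : V}
    {stack : List V} (hc : (x :: stack).IsChain fun b a => T.Forward a b) :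
    ∀ z ∈ stack, T.rank z < T.rank x := by
  induction stack generalizing x with
  | nil => simp
  | cons a stack ih =>
    rw [List.isChain_cons_cons] at hc
    have hr := rank_lt hn hc.1
    intro z hz
    rcases List.mem_cons.1 hz with rfl | hz
    · exact hr
    · exact (ih hc.2 z hz).trans hr

theorem slot_eq_slot {k : StatementKind} {hk : k ≠ .trivial} {v : V}
    {ch : Fin k.lastVertex → StatementTree V} (hn : (node k hk v ch).labels.Nodup)
    {f g : Fin k.lastVertex → V} (hf : ∀ i, f i ∈ (ch i).labels) (hg : ∀ i, g i ∈ (ch i).labels)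
    {i j : Fin (k.lastVertex + 1)} (h : slot v f i = slot v g j) : i = j := by
  obtain ⟨h1, -, h3⟩ := nodup_labels_node.1 hn
  cases i using Fin.cases with
  | zero =>
    cases j using Fin.cases with
    | zero => rfl
    | succ j =>
      simp only [slot_zero, slot_succ] at h
      exact absurd (h ▸ hg j) (h1 j)
  | succ i =>
    cases j using Fin.cases with
    | zero =>
      simp only [slot_zero, slot_succ] at h
      exact absurd (h ▸ hf i) (h1 i)
    | succ j =>
      simp only [slot_succ] at h
      rw [h3 i j _ (hf i) (h ▸ hg j)]

theorem Rel.ne : ∀ {T : StatementTree V} {x y : V}, T.labels.Nodup → T.Adj x y → x ≠ y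
  | leaf _, _, _, _, h => h.elim
  | node k hk v ch, x, y, hn, h => by
    rcases h with ⟨i, h⟩ | ⟨i, j, h, rfl, rfl⟩
    · exact Rel.ne ((nodup_labels_node.1 hn).2.1 i) h
    · intro e
      exact h.ne (by rw [slot_eq_slot hn (fun i => sink_mem _) (fun i => root_mem _) e])

/-- The head of a cycle edge lies below the tail on a stack and thus has smaller rank, which
excludes forward edges. Conversely, a search reaching the tail of a back edge has the head on its
stack. The right-hand side does not mention a search. -/
theorem Represents.isCycleEdge_iff {T : StatementTree V} {G : RootedDigraph V}
    (hT : T.Represents G) {x y : V} : G.IsCycleEdge x y ↔ T.Back x y := by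
  classical
  constructor
  · rintro ⟨hxy, stack, visited, h, hy⟩
    obtain ⟨hc, -, -⟩ := hT.stack h
    refine (adj_iff.1 ((hT.adj x y).1 hxy)).resolve_left fun hF => ?_
    exact (isChain_rank hT.nodup hc y hy).not_gt (rank_lt hT.nodup hF)
  · intro h
    obtain ⟨stack, hs, -⟩ := hT.exists_stack (reachable h.mem.1)
    obtain ⟨hc, -, hl⟩ := hT.stack hs
    refine ⟨(hT.adj x y).2 (adj_of_back h), stack, _, hs, ?_⟩
    have := mem_of_isChain hT.nodup h (hc.imp fun _ _ h => adj_of_forward h) (hl (by simp))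
    exact (List.mem_cons.1 this).resolve_left (Rel.ne hT.nodup (adj_of_back h)).symm

/-- The tree with a single internal node that describes a statement graph. -/
def star (k : StatementKind) (hk : k ≠ .trivial) (p : Fin (k.lastVertex + 1) → V) :
    StatementTree V :=
  node k hk (p 0) fun i => leaf (p i.succ)

section Star

variable {k : StatementKind} {hk : k ≠ .trivial} {p : Fin (k.lastVertex + 1) → V}

theorem slot_star (i : Fin (k.lastVertex + 1)) : slot (p 0) (fun i => p i.succ) i = p i := by
  cases i using Fin.cases <;> rfl

@[simp] theorem root_star : (star k hk p).root = p 0 := rfl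

@[simp] theorem sink_star : (star k hk p).sink = p (Fin.last _) := slot_star _

@[simp] theorem mem_labels_star {x : V} : x ∈ (star k hk p).labels ↔ ∃ i, x = p i := by
  simp only [star, mem_labels_node, mem_labels_leaf]
  exact ⟨fun h => h.elim (fun h => ⟨0, h⟩) fun ⟨i, h⟩ => ⟨i.succ, h⟩, fun ⟨i, h⟩ => by
    cases i using Fin.cases with
    | zero => exact .inl h
    | succ i => exact .inr ⟨i, h⟩⟩

theorem nodup_labels_star : (star k hk p).labels.Nodup ↔ Function.Injective p := by
  simp only [star, nodup_labels_node, mem_labels_leaf]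
  constructor
  · rintro ⟨h1, -, h3⟩ i j hij
    cases i using Fin.cases with
    | zero =>
      cases j using Fin.cases with
      | zero => rfl
      | succ j => exact absurd hij (h1 j)
    | succ i =>
      cases j using Fin.cases with
      | zero => exact absurd hij.symm (h1 i)
      | succ j => rw [h3 i j _ rfl hij]
  · intro h
    refine ⟨fun i hi => absurd (h hi) (Fin.succ_ne_zero i).symm, fun i => by simp [labels],
      fun i j x hi hj => Fin.succ_injective _ (h (hi.symm.trans hj))⟩

theorem rel_star {E : StatementKind → ℕ → ℕ → Prop} {x y : V} :
    (star k hk p).Rel E x y ↔ ∃ i j : Fin (k.lastVertex + 1), E k i j ∧ x = p i ∧ y = p j := by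
  simp [star, Rel, root, sink, slot_star]

theorem isLeaf_star {x : V} : (star k hk p).IsLeaf x ↔ ∃ i : Fin k.lastVertex, x = p i.succ :=
  Iff.rfl

theorem represents_statementGraph (k : StatementKind) (hk : k ≠ .trivial) :
    (star k hk fun i => (i : ℕ)).Represents k.graph where
  nodup := nodup_labels_star.2 Fin.val_injective
  source := rfl
  mem_verts x := by
    simp only [StatementKind.graph, Finset.mem_range, mem_labels_star]
    exact ⟨fun h => ⟨⟨x, h⟩, rfl⟩, fun ⟨i, h⟩ => h ▸ i.2⟩
  adj x y := by
    refine Iff.trans ?_ rel_star.symm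
    constructor
    · intro h
      have := StatementKind.Edge.le h
      exact ⟨⟨x, by omega⟩, ⟨y, by omega⟩, h, rfl, rfl⟩
    · rintro ⟨i, j, h, rfl, rfl⟩
      exact h

theorem isCycleEdge_statementGraph (hk : k ≠ .trivial) (i j : Fin (k.lastVertex + 1)) :
    k.graph.IsCycleEdge i j ↔ k.BackEdge i j := by
  refine (represents_statementGraph k hk).isCycleEdge_iff.trans (rel_star.trans ?_)
  exact ⟨fun ⟨i', j', h, hi, hj⟩ => by rwa [hi, hj], fun h => ⟨i, j, h, rfl, rfl⟩⟩

end Star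

end StatementTree

/-! ### Uniqueness of the prime subgraph with a given source -/

namespace StatementKind

/-- The number of out-neighbours of the source of a statement graph. -/
def outDegree : StatementKind → ℕ
  | .trivial => 0
  | .sequence => 1
  | .ifThen => 2
  | .while => 2
  | .repeat => 1
  | .ifThenElse => 2
  | .pCase p _ => p

/-- Some vertex is at distance two from the source. -/
def IsDeep : StatementKind → Prop
  | .repeat => True
  | .ifThenElse => True
  | .pCase _ _ => True
  | _ => False

theorem edge_zero_iff (k : StatementKind) (j : ℕ) : k.Edge 0 j ↔ 1 ≤ j ∧ j ≤ k.outDegree := by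
  cases k <;> grind [Edge, outDegree]

theorem exists_edge_edge_zero (k : StatementKind) :
    (∃ i, k.Edge 0 i ∧ k.Edge i 0) ↔ k = .while ∨ k = .repeat := by
  constructor
  · rintro ⟨i, h⟩
    cases k <;> grind [Edge]
  · rintro (rfl | rfl) <;> exact ⟨1, by grind [Edge]⟩

theorem exists_triangle (k : StatementKind) :
    (∃ i j, k.Edge 0 i ∧ k.Edge 0 j ∧ k.Edge i j) ↔ k = .ifThen := by
  constructor
  · rintro ⟨i, j, h⟩
    cases k <;> grind [Edge]
  · rintro rfl
    exact ⟨1, 2, by grind [Edge]⟩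

/-- All three invariants are visible from the source: its out-degree, a 2-cycle through it, and an
edge between two of its out-neighbours. -/
theorem eq_of_invariants {k k' : StatementKind} (hk : k ≠ .trivial) (hk' : k' ≠ .trivial)
    (h1 : k.outDegree = k'.outDegree) (h2 : (k = .while ∨ k = .repeat) ↔ (k' = .while ∨ k' = .repeat))
    (h3 : k = .ifThen ↔ k' = .ifThen) : k = k' := by
  cases k <;> cases k' <;> simp_all [outDegree] <;> omega

theorem IsDeep.lt {k : StatementKind} (hk : k.IsDeep) {j : ℕ} (h : k.Edge 0 j) :
    j < k.lastVertex := by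
  cases k <;> grind [Edge, lastVertex, IsDeep]

/-- Used to recover the vertex set from the source. The second neighbourhood is taken for deep kinds
only, because elsewhere an out-neighbour of the source may be the sink, whose edges leave the prime
subgraph. -/
theorem near_source {k : StatementKind} {i : ℕ} (hi : i ≤ k.lastVertex) :
    i = 0 ∨ k.Edge 0 i ∨ (k.IsDeep ∧ ∃ j, k.Edge 0 j ∧ k.Edge j i) := by
  cases k
  case ifThenElse =>
    by_cases h : i = 3
    · exact .inr (.inr ⟨True.intro, 1, by grind [Edge]⟩)
    · grind [Edge, lastVertex]
  case pCase p hp =>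
    by_cases h : i = p + 1
    · exact .inr (.inr ⟨True.intro, 1, by grind [Edge]⟩)
    · grind [Edge, lastVertex]
  all_goals
    by_cases h : i = 2
    · first
        | exact .inr (.inr ⟨True.intro, 1, by grind [Edge]⟩)
        | grind [Edge, lastVertex]
    · grind [Edge, lastVertex]

end StatementKind

namespace RootedDigraph

variable {V : Type u}

/-- `p` enumerates the vertices of the prime subgraph `H` of `G` in the order of the vertices of
the statement graph of the kind `k`. -/
structure PrimeChart (k : StatementKind) (H G : RootedDigraph V)
    (p : Fin (k.lastVertex + 1) → V) : Prop where
  injective : Function.Injective p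
  source : p 0 = H.source
  mem_verts : ∀ x, x ∈ H.verts ↔ ∃ i, x = p i
  adj : ∀ x y, H.Adj x y ↔ x ∈ H.verts ∧ y ∈ H.verts ∧ G.Adj x y
  adj_iff : ∀ i j, G.Adj (p i) (p j) ↔ k.Edge i j
  isCycleEdge_iff : ∀ i j, G.IsCycleEdge (p i) (p j) ↔ k.BackEdge i j
  adj_to : ∀ i b, i ≠ 0 → G.Adj b (p i) → ∃ j, b = p j
  adj_from : ∀ i b, i ≠ Fin.last _ → G.Adj (p i) b → ∃ j, b = p j
  cycle_source : ∀ a, G.IsCycleEdge a (p 0) → G.Adj (p 0) a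

theorem exists_enumeration {k : StatementKind} {H : RootedDigraph V}
    {f : k.graph.verts ≃ H.verts} (hf : IsIso k.graph H f) :
    ∃ p : Fin (k.lastVertex + 1) → V, Function.Injective p ∧ p 0 = H.source ∧
      (∀ x, x ∈ H.verts ↔ ∃ i, x = p i) ∧ (∀ i j, H.Adj (p i) (p j) ↔ k.Edge i j) ∧
      ∀ (i : Fin (k.lastVertex + 1)) (hi : (i : ℕ) ∈ k.graph.verts), (f ⟨i, hi⟩ : V) = p i := by
  have hm : ∀ i : Fin (k.lastVertex + 1), (i : ℕ) ∈ k.graph.verts := fun i =>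
    Finset.mem_range.2 i.2
  refine ⟨fun i => f ⟨i, hm i⟩, ?_, hf.1, ?_, ?_, fun _ _ => rfl⟩
  · intro i j hij
    have := f.injective (Subtype.ext hij)
    exact Fin.ext (by simpa using this)
  · intro x
    constructor
    · intro hx
      obtain ⟨⟨i, hi⟩, h⟩ := f.surjective ⟨x, hx⟩
      exact ⟨⟨i, Finset.mem_range.1 hi⟩, by simp [h]⟩
    · rintro ⟨i, rfl⟩
      exact (f _).2
  · intro i j
    exact (hf.2 ⟨i, hm i⟩ ⟨j, hm j⟩).symm

theorem eq_last_of_isSink {k : StatementKind} {H : RootedDigraph V} {t : V} (ht : H.IsSink t)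
    {p : Fin (k.lastVertex + 1) → V} (hp : Function.Injective p)
    (hv : ∀ x, x ∈ H.verts ↔ ∃ i, x = p i) (ha : ∀ i j, H.Adj (p i) (p j) ↔ k.Edge i j) :
    t = p (Fin.last _) := by
  obtain ⟨i, rfl⟩ := (hv t).1 ht.1
  by_cases hi : i = Fin.last _
  · rw [hi]
  · obtain ⟨j, hj⟩ := StatementKind.exists_edge_from (k := k) (i := i)
      (by have := Fin.val_lt_last hi; simpa using this)
    have hjl : j < k.lastVertex + 1 := by have := hj.le; omega
    have := hp (ht.2 _ (.single ((ha i ⟨j, hjl⟩).2 hj)))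
    exact absurd (congrArg Fin.val this).symm hj.ne

theorem isSink_last {k : StatementKind} {H : RootedDigraph V} {p : Fin (k.lastVertex + 1) → V}
    (hv : ∀ x, x ∈ H.verts ↔ ∃ i, x = p i) (ha : ∀ i j, H.Adj (p i) (p j) ↔ k.Edge i j) :
    H.IsSink (p (Fin.last _)) := by
  refine ⟨(hv _).2 ⟨_, rfl⟩, fun b hb => ?_⟩
  rcases hb.cases_head with h | ⟨c, hc, -⟩
  · exact h.symm
  · obtain ⟨j, rfl⟩ := (hv c).1 (H.right_mem hc)
    exact absurd ((ha _ _).1 hc) (StatementKind.not_edge_lastVertex k j)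

theorem IsPrimeIn.exists_chart {k : StatementKind} {H G : RootedDigraph V}
    (h : IsPrimeIn k H G) : k ≠ .trivial ∧ H.verts ⊆ G.verts ∧ ∃ p, PrimeChart k H G p := by
  obtain ⟨hk, ⟨hsub, hadj⟩, ⟨t, ht, hin, hout, hcs⟩, f, hf, hcyc⟩ := h
  obtain ⟨p, hp, hp0, hv, ha, hfp⟩ := exists_enumeration hf
  have hm : ∀ i : Fin (k.lastVertex + 1), (i : ℕ) ∈ k.graph.verts := fun i =>
    Finset.mem_range.2 i.2
  have hpv : ∀ i, p i ∈ H.verts := fun i => (hv _).2 ⟨i, rfl⟩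
  obtain rfl := eq_last_of_isSink ht hp hv ha
  refine ⟨hk, hsub, p, hp, hp0, hv, hadj, fun i j => ?_, fun i j => ?_, fun i b hi hb => ?_,
    fun i b hi hb => ?_, fun a h => ?_⟩
  · rw [← ha, hadj]
    simp [hpv]
  · rw [← StatementTree.isCycleEdge_statementGraph hk, ← hfp i (hm i), ← hfp j (hm j)]
    exact (hcyc ⟨i, hm i⟩ ⟨j, hm j⟩).symm
  · exact (hv b).1 (hin _ (hpv i) (fun e => hi (hp (e.trans hp0.symm))) b hb)
  · exact (hv b).1 (hout _ (hpv i) (fun e => hi (hp e)) b hb)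
  · rw [hp0] at h ⊢
    exact hcs a h

namespace PrimeChart

variable {k k' : StatementKind} {H H' G : RootedDigraph V} {p : Fin (k.lastVertex + 1) → V}
  {q : Fin (k'.lastVertex + 1) → V}

theorem isPrimeIn (h : PrimeChart k H G p) (hk : k ≠ .trivial) (hs : H.verts ⊆ G.verts) :
    IsPrimeIn k H G := by
  have hpv : ∀ i, p i ∈ H.verts := fun i => (h.mem_verts _).2 ⟨i, rfl⟩
  have ha : ∀ i j, H.Adj (p i) (p j) ↔ k.Edge i j := fun i j => by
    rw [h.adj, ← h.adj_iff]
    simp [hpv]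
  refine ⟨hk, ⟨hs, h.adj⟩, ⟨p (Fin.last _), isSink_last h.mem_verts ha, ?_, ?_, ?_⟩, ?_⟩
  · intro a hx hne b hb
    obtain ⟨i, rfl⟩ := (h.mem_verts a).1 hx
    refine (h.mem_verts b).2 (h.adj_to i b ?_ hb)
    rintro rfl
    exact hne h.source
  · intro a hx hne b hb
    obtain ⟨i, rfl⟩ := (h.mem_verts a).1 hx
    refine (h.mem_verts b).2 (h.adj_from i b ?_ hb)
    rintro rfl
    exact hne rfl
  · rw [← h.source]
    exact h.cycle_source
  · let f : k.graph.verts → H.verts := fun a =>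
      ⟨p ⟨a, Finset.mem_range.1 a.2⟩, hpv _⟩
    have hf : Function.Bijective f := by
      constructor
      · intro a b hab
        have := h.injective (congrArg Subtype.val hab)
        exact Subtype.ext (congrArg Fin.val this)
      · rintro ⟨x, hx⟩
        obtain ⟨i, rfl⟩ := (h.mem_verts x).1 hx
        exact ⟨⟨i, Finset.mem_range.2 i.2⟩, rfl⟩
    refine ⟨Equiv.ofBijective f hf, ⟨h.source, fun a b => ?_⟩, fun a b => ?_⟩
    · exact (ha ⟨a, Finset.mem_range.1 a.2⟩ ⟨b, Finset.mem_range.1 b.2⟩).symm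
    · exact (StatementTree.isCycleEdge_statementGraph hk ⟨a, Finset.mem_range.1 a.2⟩
        ⟨b, Finset.mem_range.1 b.2⟩).trans (h.isCycleEdge_iff _ _).symm

theorem adj_from_iff (h : PrimeChart k H G p) {i : Fin (k.lastVertex + 1)} (hi : i ≠ Fin.last _)
    (y : V) : G.Adj (p i) y ↔ ∃ j : Fin (k.lastVertex + 1), k.Edge i j ∧ y = p j := by
  constructor
  · intro hy
    obtain ⟨j, rfl⟩ := h.adj_from i y hi hy
    exact ⟨j, (h.adj_iff i j).1 hy, rfl⟩
  · rintro ⟨j, hj, rfl⟩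
    exact (h.adj_iff i j).2 hj

theorem adj_source_iff (h : PrimeChart k H G p) (hk : k ≠ .trivial) (y : V) :
    G.Adj (p 0) y ↔ ∃ j : Fin (k.lastVertex + 1), k.Edge 0 j ∧ y = p j := by
  refine h.adj_from_iff (fun e => ?_) y
  have := congrArg Fin.val e
  have := StatementKind.lastVertex_pos hk
  simp at *
  omega

theorem ncard_outNbr (h : PrimeChart k H G p) (hk : k ≠ .trivial) :
    (G.outNbr (p 0)).ncard = k.outDegree := by
  have e : G.outNbr (p 0) = p '' {j | k.Edge 0 j} := by
    ext y
    simp only [outNbr, Set.mem_ofPred_eq, h.adj_source_iff hk, Set.mem_image]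
    exact ⟨fun ⟨j, hj, e⟩ => ⟨j, hj, e.symm⟩, fun ⟨j, hj, e⟩ => ⟨j, hj, e.symm⟩⟩
  have e' : ((fun j : Fin (k.lastVertex + 1) => (j : ℕ)) '' {j | k.Edge 0 j}) =
      (Finset.Icc 1 k.outDegree : Finset ℕ) := by
    ext j
    simp only [Set.mem_image, Set.mem_ofPred_eq, Finset.coe_Icc, Set.mem_Icc,
      StatementKind.edge_zero_iff]
    constructor
    · rintro ⟨i, hi, rfl⟩
      exact hi
    · intro hj
      have := ((StatementKind.edge_zero_iff k j).2 hj).le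
      exact ⟨⟨j, by omega⟩, hj, rfl⟩
  rw [e, Set.ncard_image_of_injective _ h.injective,
    ← Set.ncard_image_of_injective _ Fin.val_injective, e', Set.ncard_coe_finset]
  simp

theorem exists_cycle_iff (h : PrimeChart k H G p) (hk : k ≠ .trivial) :
    (∃ y, G.Adj (p 0) y ∧ G.Adj y (p 0)) ↔ k = .while ∨ k = .repeat := by
  rw [← StatementKind.exists_edge_edge_zero]
  constructor
  · rintro ⟨y, h1, h2⟩
    obtain ⟨j, hj, rfl⟩ := (h.adj_source_iff hk y).1 h1
    exact ⟨j, hj, (h.adj_iff j 0).1 h2⟩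
  · rintro ⟨i, h1, h2⟩
    have hi : i < k.lastVertex + 1 := by have := h1.le; omega
    exact ⟨p ⟨i, hi⟩, (h.adj_iff 0 ⟨i, hi⟩).2 h1, (h.adj_iff ⟨i, hi⟩ 0).2 h2⟩

theorem exists_triangle_iff (h : PrimeChart k H G p) (hk : k ≠ .trivial) :
    (∃ x y, G.Adj (p 0) x ∧ G.Adj (p 0) y ∧ G.Adj x y) ↔ k = .ifThen := by
  rw [← StatementKind.exists_triangle]
  constructor
  · rintro ⟨x, y, h1, h2, h3⟩
    obtain ⟨i, hi, rfl⟩ := (h.adj_source_iff hk x).1 h1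
    obtain ⟨j, hj, rfl⟩ := (h.adj_source_iff hk y).1 h2
    exact ⟨i, j, hi, hj, (h.adj_iff i j).1 h3⟩
  · rintro ⟨i, j, h1, h2, h3⟩
    have hi : i < k.lastVertex + 1 := by have := h1.le; omega
    have hj : j < k.lastVertex + 1 := by have := h2.le; omega
    exact ⟨p ⟨i, hi⟩, p ⟨j, hj⟩, (h.adj_iff 0 ⟨i, hi⟩).2 h1, (h.adj_iff 0 ⟨j, hj⟩).2 h2,
      (h.adj_iff ⟨i, hi⟩ ⟨j, hj⟩).2 h3⟩

theorem mem_verts_iff (h : PrimeChart k H G p) (hk : k ≠ .trivial) (x : V) :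
    x ∈ H.verts ↔ x = p 0 ∨ G.Adj (p 0) x ∨
      (k.IsDeep ∧ ∃ y, G.Adj (p 0) y ∧ G.Adj y x) := by
  rw [h.mem_verts]
  constructor
  · rintro ⟨i, rfl⟩
    rcases StatementKind.near_source (Nat.lt_succ_iff.1 i.2) with hi | hi | ⟨hd, j, hj, hi⟩
    · exact .inl (congrArg p (Fin.ext hi))
    · exact .inr (.inl ((h.adj_iff 0 i).2 hi))
    · have hjl : j < k.lastVertex + 1 := by have := hj.le; omega
      exact .inr (.inr ⟨hd, p ⟨j, hjl⟩, (h.adj_iff 0 ⟨j, hjl⟩).2 hj,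
        (h.adj_iff ⟨j, hjl⟩ i).2 hi⟩)
  · rintro (rfl | h1 | ⟨hd, y, h1, h2⟩)
    · exact ⟨0, rfl⟩
    · obtain ⟨j, -, rfl⟩ := (h.adj_source_iff hk x).1 h1
      exact ⟨j, rfl⟩
    · obtain ⟨j, hj, rfl⟩ := (h.adj_source_iff hk y).1 h1
      refine h.adj_from j x ?_ h2
      rintro rfl
      exact absurd (hd.lt hj) (by simp)

/-- A prime subgraph is determined by its source. -/
theorem unique (h : PrimeChart k H G p) (h' : PrimeChart k' H' G q) (hk : k ≠ .trivial)
    (hk' : k' ≠ .trivial) (e : p 0 = q 0) : k = k' ∧ H = H' := by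
  obtain rfl : k = k' := by
    refine StatementKind.eq_of_invariants hk hk' ?_ ?_ ?_
    · rw [← h.ncard_outNbr hk, ← h'.ncard_outNbr hk', e]
    · rw [← h.exists_cycle_iff hk, ← h'.exists_cycle_iff hk', e]
    · rw [← h.exists_triangle_iff hk, ← h'.exists_triangle_iff hk', e]
  refine ⟨rfl, ?_⟩
  have hv : H.verts = H'.verts := by
    ext x
    rw [h.mem_verts_iff hk, h'.mem_verts_iff hk, e]
  have ha : H.Adj = H'.Adj := by
    funext x y
    rw [eq_iff_iff, h.adj, h'.adj, hv]
  have hs : H.source = H'.source := by rw [← h.source, ← h'.source, e]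
  cases H
  cases H'
  simp only at hv ha hs
  subst hv ha hs
  rfl

end PrimeChart

end RootedDigraph

/-! ### Prime subgraphs occur exactly at internal nodes without internal nodes below -/

namespace StatementTree

variable {V : Type u}

theorem not_adj_sink : ∀ {T : StatementTree V} {y : V}, T.labels.Nodup → ¬ T.Adj T.sink y
  | leaf _, _, _, h => h
  | node k hk v ch, y, hn, h => by
    obtain ⟨h1, h2, h3⟩ := nodup_labels_node.1 hn
    rcases h with ⟨i, h⟩ | ⟨i, j, h, e, -⟩
    · have hm := h.mem.1
      have hs : ∀ l, slot v (fun i => (ch i).sink) l ∈ (ch i).labels →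
          slot v (fun i => (ch i).sink) l = (ch i).sink := by
        intro l hl
        cases l using Fin.cases with
        | zero => exact absurd hl (h1 i)
        | succ l =>
          simp only [slot_succ] at hl ⊢
          rw [h3 l i _ (sink_mem _) hl]
      rw [sink, hs _ hm] at h
      exact not_adj_sink (h2 i) h
    · have := slot_eq_slot hn (fun i => sink_mem _) (fun i => sink_mem _) e
      subst this
      exact StatementKind.not_edge_lastVertex k j h

theorem root_mem_of_closed {T : StatementTree V} {R : Set V}
    (hR : ∀ x y, T.Forward x y → y ∈ R → x ∈ R) {z : V} (hz : z ∈ T.labels) (hzR : z ∈ R) :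
    T.root ∈ R := by
  have := reachable hz
  induction this with
  | refl => exact hzR
  | tail _ h ih => exact ih h.mem.1 (hR _ _ h hzR)

/-- If a leaf is neither the sink nor the tail of a cycle edge, then the vertices that follow it
can be reached from the source without passing through it. -/
theorem root_mem_of_isLeaf : ∀ {T : StatementTree V} {v : V} {R : Set V}, T.labels.Nodup →
    T.IsLeaf v → v ≠ T.sink → (∀ y, ¬ T.Back v y) → (∀ y, T.Forward v y → y ∈ R) →
    (∀ x y, T.Forward x y → y ∈ R → x = v ∨ x ∈ R) → T.root ∈ R
  | leaf _, _, _, _, h, h', _, _, _ => absurd h h'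
  | node k hk u ch, v, R, hn, ⟨i, hv⟩, hs, hB, hF, hR => by
    obtain ⟨h1, h2, h3⟩ := nodup_labels_node.1 hn
    have hmv : ∀ j : Fin (k.lastVertex + 1), j ≠ i.succ →
        slot u (fun i => (ch i).sink) j ≠ v := by
      intro j hj e
      cases j using Fin.cases with
      | zero => exact h1 i (by simpa [← e] using hv.mem)
      | succ j =>
        simp only [slot_succ] at e
        exact hj (by rw [h3 j i v (e ▸ sink_mem _) hv.mem])
    -- A branch not containing `v` can be crossed backwards inside `R`, from its sink to its root.
    have hA : ∀ j : Fin (k.lastVertex + 1), j ≠ i.succ →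
        slot u (fun i => (ch i).sink) j ∈ R → slot u (fun i => (ch i).root) j ∈ R := by
      intro j hj hjR
      cases j using Fin.cases with
      | zero => exact hjR
      | succ j =>
        refine root_mem_of_closed (T := ch j) (fun x y hxy hy => ?_) (sink_mem _) hjR
        refine (hR x y (.inl ⟨j, hxy⟩) hy).resolve_left ?_
        rintro rfl
        exact hj (by rw [h3 j i x hxy.mem.1 hv.mem])
    -- Forward predecessors have smaller slot numbers, so going back from a slot not beyond that of
    -- `v` never crosses the branch containing `v`.
    have hC : ∀ n (hn : n < k.lastVertex + 1), n ≤ i.succ →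
        slot u (fun i => (ch i).root) ⟨n, hn⟩ ∈ R → u ∈ R := by
      intro n
      induction n using Nat.strong_induction_on with
      | _ n ih =>
        intro hnl hni hnR
        rcases Nat.eq_zero_or_pos n with rfl | hn0
        · exact hnR
        · obtain ⟨j, hj⟩ := StatementKind.exists_forwardEdge_to (k := k) hn0 (by omega)
          have hjl : j < k.lastVertex + 1 := by have := hj.1.le; omega
          have hjn := hj.2
          have hji : (⟨j, hjl⟩ : Fin (k.lastVertex + 1)) ≠ i.succ := by
            intro e
            have := congrArg Fin.val e
            simp only at this
            omega
          refine ih j hjn hjl (by omega) (hA _ hji ?_)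
          exact (hR _ _ (.inr ⟨⟨j, hjl⟩, ⟨n, hnl⟩, hj, rfl, rfl⟩) hnR).resolve_left (hmv _ hji)
    change u ∈ R
    -- If `v` is the sink of its branch, then its branch is not the last one, and the bypass leads
    -- from the sink slot back to `u` around that branch. Otherwise recursion puts the root of the
    -- branch in `R`, and `hC` finishes.
    by_cases hvs : v = (ch i).sink
    · have hil : (i.succ : ℕ) < k.lastVertex := by
        by_contra hil
        refine hs ?_
        have : Fin.last k.lastVertex = i.succ := Fin.ext (by simp at *; omega)
        rw [sink, this, slot_succ, hvs]
      rcases StatementKind.backEdge_or_bypass (Nat.succ_pos _) hil with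
        ⟨j, hj⟩ | ⟨hl, j, hji, hj, h0⟩
      · have hjl : j < k.lastVertex + 1 := by have := hj.1.le; omega
        exact absurd (.inr ⟨i.succ, ⟨j, hjl⟩, hj, hvs, rfl⟩) (hB (slot u (fun i => (ch i).root) ⟨j, hjl⟩))
      · have hlR := hF _ (.inr ⟨i.succ, Fin.last _, hl, hvs, rfl⟩)
        have hjl : j < k.lastVertex + 1 := by have := hj.1.le; omega
        have hji' : (⟨j, hjl⟩ : Fin (k.lastVertex + 1)) ≠ i.succ := fun e =>
          hji (by simpa using congrArg Fin.val e)
        have hjR := hA _ hji' ((hR _ _ (.inr ⟨⟨j, hjl⟩, Fin.last _, hj, rfl, rfl⟩)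
          hlR).resolve_left (hmv _ hji'))
        rcases h0 with rfl | h0
        · exact hjR
        · exact (hR u _ (.inr ⟨0, ⟨j, hjl⟩, h0, rfl, rfl⟩) hjR).resolve_left
            (hmv 0 (Fin.succ_ne_zero i).symm)
    · refine hC i.succ i.succ.2 le_rfl ?_
      exact root_mem_of_isLeaf (h2 i) hv hvs (fun y h => hB y (.inl ⟨i, h⟩))
        (fun y h => hF y (.inl ⟨i, h⟩)) fun x y h => hR x y (.inl ⟨i, h⟩)

theorem Rel.isInternal : ∀ {T : StatementTree V} {x y : V}, T.Back x y → T.IsInternal y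
  | leaf _, _, _, h => h.elim
  | node k hk v ch, x, y, h => by
    rcases h with ⟨i, h⟩ | ⟨i, j, h, -, rfl⟩
    · exact .inr ⟨i, h.isInternal⟩
    · left
      have : j = 0 := Fin.ext h.eq.1
      simp [this]

/-- Going back along forward edges from the vertices following the leaf, the root would be reached
inside `H` without its source. Each such vertex of `H` has an incoming forward edge, but the root
has none. -/
theorem Represents.not_primeChart_of_isLeaf {T : StatementTree V} {G H : RootedDigraph V}
    (hT : T.Represents G) {k : StatementKind} {p : Fin (k.lastVertex + 1) → V}
    (hv : T.IsLeaf (p 0)) (hk : k ≠ .trivial) (hp : RootedDigraph.PrimeChart k H G p) : False := by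
  have hk0 := StatementKind.lastVertex_pos hk
  have h0 : (0 : Fin (k.lastVertex + 1)) ≠ Fin.last _ := fun e => by
    have := congrArg Fin.val e
    simp at this
    omega
  -- Closedness of `H` makes this set closed under forward predecessors, apart from `p 0`.
  have hr : T.root ∈ {x | ∃ j, j ≠ 0 ∧ x = p j} := by
    refine root_mem_of_isLeaf hT.nodup hv ?_ ?_ ?_ ?_
    · intro e
      have := (hp.adj_iff 0 ⟨1, by omega⟩).2 (StatementKind.edge_zero_one hk)
      rw [hT.adj, e] at this
      exact not_adj_sink hT.nodup this
    · intro y hy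
      obtain ⟨j, rfl⟩ := hp.adj_from 0 y h0 ((hT.adj _ _).2 (adj_of_back hy))
      exact absurd ((hp.isCycleEdge_iff 0 j).1 (hT.isCycleEdge_iff.2 hy)).2 (Nat.not_lt_zero _)
    · intro y hy
      obtain ⟨j, hj, rfl⟩ := (hp.adj_from_iff h0 y).1 ((hT.adj _ _).2 (adj_of_forward hy))
      exact ⟨j, fun e => hj.ne (by rw [e]), rfl⟩
    · rintro x _ hxy ⟨j, hj, rfl⟩
      obtain ⟨l, rfl⟩ := hp.adj_to j x hj ((hT.adj _ _).2 (adj_of_forward hxy))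
      by_cases hl : l = 0
      · exact .inl (by rw [hl])
      · exact .inr ⟨l, hl, rfl⟩
  obtain ⟨j, hj, e⟩ := hr
  obtain ⟨i, hi⟩ := StatementKind.exists_forwardEdge_to (k := k)
    (Nat.pos_of_ne_zero fun h => hj (Fin.ext h)) (Nat.lt_succ_iff.1 j.2)
  have hil : i < k.lastVertex + 1 := by have := hi.1.le; omega
  have ha := (hT.adj _ _).1 ((hp.adj_iff ⟨i, hil⟩ j).2 hi.1)
  rcases adj_iff.1 ha with h | h
  · exact not_forward_root hT.nodup _ (e ▸ h)
  · have := ((hp.isCycleEdge_iff ⟨i, hil⟩ j).1 (hT.isCycleEdge_iff.2 h)).2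
    exact absurd this hi.2.not_gt

section Bottom

variable [DecidableEq V] {T : StatementTree V} {G : RootedDigraph V} {k : StatementKind}
  {hk : k ≠ .trivial} {p : Fin (k.lastVertex + 1) → V}

/-- The subgraph of `G` induced by the vertices `p i`, with the source `p 0`. -/
def inducedGraph (G : RootedDigraph V) {m : ℕ} (p : Fin (m + 1) → V) : RootedDigraph V where
  verts := Finset.univ.image p
  Adj x y := x ∈ Finset.univ.image p ∧ y ∈ Finset.univ.image p ∧ G.Adj x y
  source := p 0
  source_mem := Finset.mem_image_of_mem _ (Finset.mem_univ _)
  left_mem h := h.1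
  right_mem h := h.2.1

theorem mem_inducedGraph {m : ℕ} {p : Fin (m + 1) → V} {x : V} :
    x ∈ (inducedGraph G p).verts ↔ ∃ i, x = p i := by
  simp [inducedGraph, eq_comm]

/-- The star reuses the name `p 0` for its root, so heads of old edges are unchanged and only their
tails move. -/
theorem rel_graft_star {E : StatementKind → ℕ → ℕ → Prop} (hl : T.IsLeaf (p 0))
    (hi : ¬ T.IsInternal (p 0)) {x y : V} :
    (T.graft (p 0) (star k hk p)).Rel E x y ↔
      (∃ i j : Fin (k.lastVertex + 1), E k i j ∧ x = p i ∧ y = p j) ∨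
        ∃ x₀, T.Rel E x₀ y ∧ x = if x₀ = p 0 then p (Fin.last _) else x₀ := by
  rw [rel_graft hi, rel_star]
  simp only [hl, true_and, sink_star, root_star]
  refine or_congr_right ⟨?_, ?_⟩
  · rintro ⟨x₀, y₀, h, hx, rfl⟩
    refine ⟨x₀, ?_, hx⟩
    split_ifs with h'
    · exact h' ▸ h
    · exact h
  · rintro ⟨x₀, h, hx⟩
    refine ⟨x₀, y, h, hx, ?_⟩
    split_ifs with h'
    · exact h'
    · rfl

variable (hG : (T.graft (p 0) (star k hk p)).Represents G) (hl : T.IsLeaf (p 0))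
  (hi : ¬ T.IsInternal (p 0))
include hG hl hi

theorem Represents.eq_zero_of_mem {i : Fin (k.lastVertex + 1)} (h : p i ∈ T.labels) : i = 0 := by
  obtain ⟨-, h2, h3⟩ := (nodup_labels_graft hl hi).1 hG.nodup
  by_contra hi0
  exact h3 _ h (fun e => hi0 (nodup_labels_star.1 h2 e)) (mem_labels_star.2 ⟨i, rfl⟩)

/-- `T` shares only the label `p 0` with the star and has no loops, so no old edge joins two
vertices of the star. -/
theorem Represents.rel_star_iff {E : StatementKind → ℕ → ℕ → Prop}
    (hE : ∀ x y, T.Rel E x y → T.Adj x y) (i j : Fin (k.lastVertex + 1)) :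
    (T.graft (p 0) (star k hk p)).Rel E (p i) (p j) ↔ E k i j := by
  obtain ⟨h1, h2, -⟩ := (nodup_labels_graft hl hi).1 hG.nodup
  have hp := nodup_labels_star.1 h2
  rw [rel_graft_star hl hi]
  constructor
  · rintro (⟨i', j', h, hi', hj'⟩ | ⟨x₀, h, hx⟩)
    · rwa [hp hi', hp hj']
    · obtain rfl := hG.eq_zero_of_mem hl hi h.mem.2
      split_ifs at hx with h0
      · exact absurd h0 (Rel.ne h1 (hE _ _ h))
      · have hi0 := hG.eq_zero_of_mem hl hi (hx ▸ h.mem.1)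
        subst hi0
        exact absurd hx.symm h0
  · exact fun h => .inl ⟨i, j, h, rfl, rfl⟩

theorem Represents.primeChart :
    RootedDigraph.PrimeChart k (inducedGraph G p) G p where
  injective := nodup_labels_star.1 ((nodup_labels_graft hl hi).1 hG.nodup).2.1
  source := rfl
  mem_verts x := mem_inducedGraph
  adj x y := Iff.rfl
  adj_iff i j := (hG.adj _ _).trans (hG.rel_star_iff hl hi (fun _ _ h => h) i j)
  isCycleEdge_iff i j := hG.isCycleEdge_iff.trans
    (hG.rel_star_iff hl hi (fun _ _ h => adj_of_back h) i j)
  adj_to i b h0 hb := by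
    rcases (rel_graft_star hl hi).1 ((hG.adj _ _).1 hb) with ⟨i', j', -, h, -⟩ | ⟨x₀, h, -⟩
    · exact ⟨i', h⟩
    · exact absurd (hG.eq_zero_of_mem hl hi h.mem.2) h0
  adj_from i b hi' hb := by
    have hp := nodup_labels_star.1 ((nodup_labels_graft hl hi).1 hG.nodup).2.1
    rcases (rel_graft_star hl hi).1 ((hG.adj _ _).1 hb) with ⟨_, j', -, -, h⟩ | ⟨x₀, h, hx⟩
    · exact ⟨j', h⟩
    · split_ifs at hx with h0
      · exact absurd (hp hx) hi'
      · have hi0 := hG.eq_zero_of_mem hl hi (hx ▸ h.mem.1)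
        subst hi0
        exact absurd hx.symm h0
  cycle_source a ha := by
    have hp := nodup_labels_star.1 ((nodup_labels_graft hl hi).1 hG.nodup).2.1
    rcases (rel_graft_star hl hi).1 (hG.isCycleEdge_iff.1 ha) with ⟨i', j', h, rfl, -⟩ | ⟨x₀, h, -⟩
    · exact (hG.adj _ _).2 ((hG.rel_star_iff hl hi (fun _ _ h => h) 0 i').2 h.eq.2)
    -- Heads of back edges are internal, so no cycle edge of `T` enters `p 0`.
    · exact absurd h.isInternal hi

theorem Represents.verts_subset : (inducedGraph G p).verts ⊆ G.verts := by
  intro x hx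
  exact (hG.mem_verts x).2 ((mem_labels_graft hi).2
    (.inr ⟨hl.mem, mem_labels_star.2 (mem_inducedGraph.1 hx)⟩))

theorem Represents.contractVertex_of_mem {x : V} (hx : x ∈ T.labels) :
    (inducedGraph G p).contractVertex x = x := by
  unfold RootedDigraph.contractVertex
  split_ifs with h
  · obtain ⟨i, rfl⟩ := mem_inducedGraph.1 h
    rw [hG.eq_zero_of_mem hl hi hx]
    rfl
  · rfl

omit hG hl hi in
theorem contractVertex_inducedGraph (i : Fin (k.lastVertex + 1)) :
    (inducedGraph G p).contractVertex (p i) = p 0 := by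
  unfold RootedDigraph.contractVertex
  rw [if_pos (mem_inducedGraph.2 ⟨i, rfl⟩)]
  rfl

/-- The contraction of a lowest node of the tree. -/
theorem Represents.contract : T.Represents (G.contract (inducedGraph G p)) := by
  have hn := ((nodup_labels_graft hl hi).1 hG.nodup).1
  have hc : ∀ x ∈ T.labels, _ := fun x => hG.contractVertex_of_mem hl hi (x := x)
  refine ⟨hn, ?_, fun x => ?_, fun x y => ?_⟩
  · change (inducedGraph G p).contractVertex G.source = _
    have : G.source = T.root := by
      rw [hG.source, root_graft hi]
      split_ifs with h
      · exact h.symm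
      · rfl
    rw [this, hc _ (root_mem T)]
  · change x ∈ G.verts.image _ ↔ _
    simp only [Finset.mem_image, hG.mem_verts, mem_labels_graft hi, mem_labels_star]
    constructor
    · rintro ⟨y, ⟨hy, -⟩ | ⟨-, i, rfl⟩, rfl⟩
      · rwa [hc y hy]
      · rw [contractVertex_inducedGraph]
        exact hl.mem
    · intro hx
      by_cases h : x = p 0
      · exact ⟨p 0, .inr ⟨hl.mem, 0, rfl⟩, by rw [hc _ hl.mem, h]⟩
      · exact ⟨x, .inl ⟨hx, h⟩, hc x hx⟩
  · change (x ≠ y ∧ ∃ x' y', G.Adj x' y' ∧ _ ∧ _) ↔ _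
    constructor
    · rintro ⟨hne, x', y', hxy, rfl, rfl⟩
      rcases (rel_graft_star hl hi).1 ((hG.adj _ _).1 hxy) with ⟨i, j, -, rfl, rfl⟩ | ⟨x₀, h, rfl⟩
      · simp [contractVertex_inducedGraph] at hne
      · rw [hc _ h.mem.2]
        split_ifs with h0
        · rw [contractVertex_inducedGraph, ← h0]
          exact h
        · rw [hc _ h.mem.1]
          exact h
    · intro h
      -- The edge is lifted before the contraction: out-edges of the contracted vertex come from the
      -- sink of the star.
      refine ⟨Rel.ne hn h, if x = p 0 then p (Fin.last _) else x, y,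
        (hG.adj _ _).2 ((rel_graft_star hl hi).2 (.inr ⟨x, h, rfl⟩)), ?_, hc _ h.mem.2⟩
      split_ifs with h0
      · rw [contractVertex_inducedGraph, h0]
      · exact hc _ h.mem.1

end Bottom

end StatementTree

/-! ### The code of a prime subgraph as a permutation of its slots -/

namespace RootedDigraph

variable {V : Type u}

/-- `π` sorts all words but the last one. -/
def SortsCodes {m : ℕ} (π : Equiv.Perm (Fin m)) (s : Fin m → List (CodeSymbol V)) : Prop :=
  (∀ i : Fin m, (i : ℕ) + 1 = m → π i = i) ∧
    ∀ i j : Fin m, i < j → (j : ℕ) + 1 < m → plainCode (s (π i)) ≤ plainCode (s (π j))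

theorem eq_singleton_of_nodup {α : Type u} {l : List α} {a : α} (hl : l.Nodup)
    (h : ∀ x, x ∈ l ↔ x = a) : l = [a] :=
  List.perm_singleton.1 ((List.perm_ext_iff_of_nodup hl (List.nodup_singleton a)).2 (by simpa))

theorem exists_isLexListing (c : V → List (CodeSymbol V)) {S : Set V} (hS : S.Finite) :
    ∃ l, IsLexListing c S l := by
  classical
  let r : V → V → Prop := fun a b => plainCode (c a) ≤ plainCode (c b)
  have : Std.Total r := ⟨fun a b => le_total (plainCode (c a)) (plainCode (c b))⟩
  have : IsTrans V r := ⟨fun a b d h h' => le_trans (a := plainCode (c a)) h h'⟩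
  have hp := List.perm_insertionSort r hS.toFinset.toList
  refine ⟨hS.toFinset.toList.insertionSort r, ?_, fun a => ?_, ?_⟩
  · exact hp.nodup_iff.2 (Finset.nodup_toList _)
  · rw [hp.mem_iff]
    simp
  · exact List.pairwise_insertionSort r _

theorem firstPart_subset (H : RootedDigraph V) (k : StatementKind) :
    H.firstPart k ⊆ {x | x ∈ H.verts} := by
  intro x hx
  cases k <;> first | exact H.right_mem hx | exact H.right_mem hx.1 | exact hx.elim

theorem secondPart_subset (H : RootedDigraph V) (k : StatementKind) :
    H.secondPart k ⊆ {x | x ∈ H.verts} := by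
  have h2 : ∀ a x, x ∈ H.outNbr2 a → x ∈ H.verts := fun a x ⟨b, _, h⟩ => H.right_mem h
  intro x hx
  cases k <;>
    first | exact h2 _ _ hx | exact h2 _ _ hx.1 | exact H.right_mem hx.1 | exact hx.elim

theorem exists_isPrimeCode (c : V → List (CodeSymbol V)) (k : StatementKind)
    (H : RootedDigraph V) : ∃ σ, IsPrimeCode c k H σ := by
  have hf : {x | x ∈ H.verts}.Finite := H.verts.finite_toSet
  obtain ⟨l₁, h₁⟩ := exists_isLexListing c (hf.subset (H.firstPart_subset k))
  obtain ⟨l₂, h₂⟩ := exists_isLexListing c (hf.subset (H.secondPart_subset k))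
  exact ⟨_, l₁, l₂, h₁, h₂, rfl⟩

namespace PrimeChart

variable {k : StatementKind} {H G : RootedDigraph V} {p : Fin (k.lastVertex + 1) → V}

theorem mem (h : PrimeChart k H G p) (i : Fin (k.lastVertex + 1)) : p i ∈ H.verts :=
  (h.mem_verts _).2 ⟨i, rfl⟩

theorem edge_iff (h : PrimeChart k H G p) (i j : Fin (k.lastVertex + 1)) :
    H.Adj (p i) (p j) ↔ k.Edge i j := by
  rw [h.adj, ← h.adj_iff]
  simp [h.mem]

theorem mem_outNbr (h : PrimeChart k H G p) (j : Fin (k.lastVertex + 1)) :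
    p j ∈ H.outNbr H.source ↔ k.Edge 0 j := by
  rw [← h.source]
  exact h.edge_iff 0 j

theorem mem_inNbr (h : PrimeChart k H G p) (j : Fin (k.lastVertex + 1)) :
    p j ∈ H.inNbr H.source ↔ k.Edge j 0 := by
  rw [← h.source]
  exact h.edge_iff j 0

theorem mem_outNbr2 (h : PrimeChart k H G p) (j : Fin (k.lastVertex + 1)) :
    p j ∈ H.outNbr2 H.source ↔ ∃ i, k.Edge 0 i ∧ k.Edge i j := by
  rw [← h.source]
  constructor
  · rintro ⟨y, h1, h2⟩
    obtain ⟨i, rfl⟩ := (h.mem_verts y).1 (H.right_mem h1)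
    exact ⟨i, (h.edge_iff 0 i).1 h1, (h.edge_iff i j).1 h2⟩
  · rintro ⟨i, h1, h2⟩
    have hi : i < k.lastVertex + 1 := by have := h1.le; omega
    exact ⟨p ⟨i, hi⟩, (h.edge_iff 0 ⟨i, hi⟩).2 h1, (h.edge_iff ⟨i, hi⟩ j).2 h2⟩

theorem eq_source_iff (h : PrimeChart k H G p) (j : Fin (k.lastVertex + 1)) :
    p j = H.source ↔ (j : ℕ) = 0 := by
  rw [← h.source, h.injective.eq_iff]
  exact ⟨fun e => by simp [e], fun e => Fin.ext e⟩

/-- The middle vertices of a case graph are interchangeable, so testing 1 and 2 suffices; without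
the quantifier the neighbourhoods can be checked kind by kind. -/
theorem exists_path_two_iff (k : StatementKind) (j : ℕ) : (∃ i, k.Edge 0 i ∧ k.Edge i j) ↔
    (k.Edge 0 1 ∧ k.Edge 1 j) ∨ (k.Edge 0 2 ∧ k.Edge 2 j) := by
  constructor
  · rintro ⟨i, h⟩
    cases k <;> grind [StatementKind.Edge]
  · exact fun h => h.elim (fun h => ⟨1, h⟩) fun h => ⟨2, h⟩

theorem mem_firstPart (h : PrimeChart k H G p) (hs : k ≠ .sequence)
    (j : Fin (k.lastVertex + 1)) :
    p j ∈ H.firstPart k ↔ 0 < (j : ℕ) ∧ (j : ℕ) < k.lastVertex := by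
  have h1 := h.mem_outNbr j
  have h2 := h.mem_outNbr2 j
  have h3 := h.mem_inNbr j
  rw [exists_path_two_iff] at h2
  have hj := j.2
  generalize (j : ℕ) = n at *
  generalize p j = x at *
  clear h
  cases k <;>
    simp only [firstPart, Set.mem_sdiff, Set.mem_inter_iff, Set.mem_empty_iff_false, h1, h2, h3] <;>
    grind [StatementKind.Edge, StatementKind.lastVertex]

theorem mem_secondPart (h : PrimeChart k H G p) (hs : k ≠ .sequence) (hk : k ≠ .trivial)
    (j : Fin (k.lastVertex + 1)) : p j ∈ H.secondPart k ↔ (j : ℕ) = k.lastVertex := by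
  have h1 := h.mem_outNbr j
  have h2 := h.mem_outNbr2 j
  have h3 := h.mem_inNbr j
  have h4 := h.eq_source_iff j
  rw [exists_path_two_iff] at h2
  have hj := j.2
  generalize (j : ℕ) = n at *
  generalize p j = x at *
  clear h
  cases k <;>
    simp only [secondPart, Set.mem_sdiff, Set.mem_singleton_iff, Set.mem_empty_iff_false, h1, h2, h3,
      h4] <;>
    grind [StatementKind.Edge, StatementKind.lastVertex]

theorem exists_list (h : PrimeChart k H G p) (hk : k ≠ .trivial) {c : V → List (CodeSymbol V)}
    {σ : List (CodeSymbol V)} (hσ : IsPrimeCode c k H σ) :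
    ∃ l : List V, l.Nodup ∧
      (∀ x, x ∈ l ↔ ∃ i : Fin (k.lastVertex + 1), 0 < (i : ℕ) ∧ (i : ℕ) < k.lastVertex ∧
        x = p i) ∧
      l.Pairwise (fun a b => plainCode (c a) ≤ plainCode (c b)) ∧
      σ = CodeSymbol.kind k.typeNumber :: (l ++ [p (Fin.last _)]).flatMap c := by
  obtain ⟨l₁, l₂, ⟨hn₁, hm₁, hp₁⟩, ⟨hn₂, hm₂, -⟩, rfl⟩ := hσ
  -- In a sequence the sink is listed by the first part and the second part is empty; for all other
  -- kinds the sink is the whole second part.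
  by_cases hs : k = .sequence
  · subst hs
    obtain rfl : l₁ = [p (Fin.last _)] := by
      refine eq_singleton_of_nodup hn₁ fun x => ?_
      rw [hm₁]
      constructor
      · intro hx
        obtain ⟨i, rfl⟩ := (h.mem_verts x).1 (H.right_mem hx)
        exact congrArg p (Fin.ext ((h.mem_outNbr i).1 hx).2)
      · rintro rfl
        exact (h.mem_outNbr _).2 ⟨rfl, rfl⟩
    obtain rfl : l₂ = [] := List.eq_nil_iff_forall_not_mem.2 fun x hx => (hm₂ x).1 hx
    refine ⟨[], List.nodup_nil, fun x => ?_, .nil, by simp⟩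
    simp only [List.not_mem_nil, false_iff]
    rintro ⟨i, h0, h1, -⟩
    exact absurd h1 (by simp only [StatementKind.lastVertex]; omega)
  · obtain rfl : l₂ = [p (Fin.last _)] := by
      refine eq_singleton_of_nodup hn₂ fun x => ?_
      rw [hm₂]
      constructor
      · intro hx
        obtain ⟨i, rfl⟩ := (h.mem_verts x).1 (H.secondPart_subset k hx)
        exact congrArg p (Fin.ext ((h.mem_secondPart hs hk i).1 hx))
      · rintro rfl
        exact (h.mem_secondPart hs hk _).2 rfl
    refine ⟨l₁, hn₁, fun x => ?_, hp₁, by simp⟩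
    rw [hm₁]
    constructor
    · intro hx
      obtain ⟨i, rfl⟩ := (h.mem_verts x).1 (H.firstPart_subset k hx)
      obtain ⟨h1, h2⟩ := (h.mem_firstPart hs i).1 hx
      exact ⟨i, h1, h2, rfl⟩
    · rintro ⟨i, h1, h2, rfl⟩
      exact (h.mem_firstPart hs i).2 ⟨h1, h2⟩

theorem exists_perm (h : PrimeChart k H G p) (hk : k ≠ .trivial) {c : V → List (CodeSymbol V)}
    {σ : List (CodeSymbol V)} (hσ : IsPrimeCode c k H σ) :
    ∃ π : Equiv.Perm (Fin k.lastVertex), SortsCodes π (fun i => c (p i.succ)) ∧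
      σ = CodeSymbol.kind k.typeNumber :: (List.ofFn fun i => c (p (π i).succ)).flatten := by
  obtain ⟨l, hn, hm, hs, rfl⟩ := h.exists_list hk hσ
  have hk0 := StatementKind.lastVertex_pos hk
  have hnL : (l ++ [p (Fin.last _)]).Nodup := by
    rw [List.nodup_append]
    refine ⟨hn, List.nodup_singleton _, fun a ha b hb => ?_⟩
    obtain ⟨i, -, h2, rfl⟩ := (hm a).1 ha
    obtain rfl := List.mem_singleton.1 hb
    intro e
    rw [h.injective e] at h2
    simp at h2
  have hmL : ∀ x, x ∈ l ++ [p (Fin.last _)] ↔ ∃ i : Fin k.lastVertex, p i.succ = x := by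
    intro x
    rw [List.mem_append, hm, List.mem_singleton]
    constructor
    · rintro (⟨i, h1, -, rfl⟩ | rfl)
      · exact ⟨i.pred fun e => by simp [e] at h1, by simp⟩
      · exact ⟨⟨k.lastVertex - 1, by omega⟩, congrArg p (Fin.ext (by simp; omega))⟩
    · rintro ⟨i, rfl⟩
      by_cases hi : (i : ℕ) + 1 = k.lastVertex
      · exact .inr (congrArg p (Fin.ext (by simpa using hi)))
      · exact .inl ⟨i.succ, by simp, by have := i.2; simp; omega, rfl⟩
  have hlen : (l ++ [p (Fin.last _)]).length = k.lastVertex := by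
    have hnF : (List.ofFn fun i : Fin k.lastVertex => p i.succ).Nodup :=
      List.nodup_ofFn.2 (h.injective.comp (Fin.succ_injective _))
    have := (List.perm_ext_iff_of_nodup hnL hnF).2 fun x => by
      rw [hmL, List.mem_ofFn]
    simpa using this.length_eq
  -- The permutation sends a position in the listing to the slot of the vertex listed there. The
  -- sink comes last in the listing, so its slot is fixed.
  have hg : ∀ i : Fin k.lastVertex, ∃ j : Fin k.lastVertex,
      p j.succ = (l ++ [p (Fin.last _)])[(i : ℕ)]'(by rw [hlen]; exact i.2) := fun i =>
    (hmL _).1 (List.getElem_mem _)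
  choose g hg using hg
  have hgi : Function.Injective g := by
    intro i j hij
    have := hg i
    rw [hij, hg j, hnL.getElem_inj_iff] at this
    exact (Fin.ext this).symm
  have hll : l.length + 1 = k.lastVertex := by simpa using hlen
  refine ⟨Equiv.ofBijective g (Finite.injective_iff_bijective.1 hgi), ⟨fun i hi => ?_,
    fun i j hij hj => ?_⟩, ?_⟩
  · have hil : (i : ℕ) = l.length := by omega
    have := hg i
    simp only [hil, List.getElem_concat_length] at this
    have := congrArg Fin.val (h.injective this)
    exact Fin.ext (by simp at this ⊢; omega)
  · have hij' : (i : ℕ) < j := hij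
    have hi' := hg i
    have hj' := hg j
    rw [List.getElem_append_left (by omega)] at hi' hj'
    simp only [Equiv.ofBijective_apply, hi', hj']
    exact List.pairwise_iff_getElem.1 hs i j (by omega) (by omega) hij'
  · rw [List.flatMap_def]
    congr 2
    refine List.ext_getElem (by simp [hll]) fun n h1 h2 => ?_
    have hn' : n < k.lastVertex := by simpa using h2
    rw [List.getElem_map, List.getElem_ofFn, Equiv.ofBijective_apply, hg]

end PrimeChart

end RootedDigraph

/-! ### Runs of the algorithm compute codes of the tree -/

namespace StatementTree

open RootedDigraph

variable {V : Type u} {W : Type v}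

/-- `σ` is a code of the tree whose vertices have the codes `c`. -/
def IsTreeCode (c : V → List (CodeSymbol V)) : StatementTree V → List (CodeSymbol V) → Prop
  | leaf a, σ => σ = c a
  | node k _ a ch, σ => ∃ (π : Equiv.Perm (Fin k.lastVertex))
      (s : Fin k.lastVertex → List (CodeSymbol V)), (∀ i, (ch i).IsTreeCode c (s i)) ∧
      SortsCodes π s ∧
      σ = c a ++ CodeSymbol.kind k.typeNumber :: (List.ofFn fun i => s (π i)).flatten

/-- The invariant of a contraction: once `S` has shrunk to the vertex `a` carrying a code of `S`,
any code of the smaller tree is a code of the original one. -/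
theorem IsTreeCode.graft [DecidableEq V] {c : V → List (CodeSymbol V)} {a : V}
    {S : StatementTree V} {ρ : List (CodeSymbol V)} (hS : S.IsTreeCode c ρ) :
    ∀ {T : StatementTree V} {σ : List (CodeSymbol V)}, ¬ T.IsInternal a →
      T.IsTreeCode (Function.update c a ρ) σ → (T.graft a S).IsTreeCode c σ
  | leaf x, σ, _, h => by
    change σ = _ at h
    by_cases hx : x = a
    · subst hx
      simpa [StatementTree.graft, h] using hS
    · simp only [StatementTree.graft, hx, if_false]
      change σ = _
      simpa [hx] using h
  | node k hk x ch, σ, hi, ⟨π, s, h1, h2, h3⟩ => by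
    have hx : x ≠ a := fun h => hi (.inl h.symm)
    exact ⟨π, s, fun i => IsTreeCode.graft hS (fun h => hi (.inr ⟨i, h⟩)) (h1 i), h2,
      by simpa [hx] using h3⟩

theorem eq_leaf_of_forall_not_isInternal {T : StatementTree V} (h : ∀ x, ¬ T.IsInternal x) :
    T = leaf T.root := by
  cases T with
  | leaf a => rfl
  | node k hk a ch => exact absurd (.inl rfl) (h a)

/-- A lowest internal node carries a statement graph. -/
theorem exists_eq_graft_star [DecidableEq V] {T : StatementTree V} {a : V} (hn : T.labels.Nodup)
    (ha : T.IsInternal a) (hA : ∀ x, T.IsInternal x → ¬ T.Above a x) :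
    ∃ (T' : StatementTree V) (k : StatementKind) (hk : k ≠ .trivial)
      (p : Fin (k.lastVertex + 1) → V), p 0 = a ∧ T = T'.graft (p 0) (star k hk p) ∧
      T'.IsLeaf (p 0) ∧ ¬ T'.IsInternal (p 0) := by
  obtain ⟨T', k, hk, ch, e, hl, hi, hch⟩ := exists_eq_graft hn ha
  have hleaf : ∀ i, ch i = leaf (ch i).root := fun i =>
    eq_leaf_of_forall_not_isInternal fun x hx =>
      hA x (Above.isInternal (hch i x hx)).2 (hch i x hx)
  refine ⟨T', k, hk, slot a fun i => (ch i).root, rfl, ?_, hl, hi⟩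
  have : ch = fun i => leaf (ch i).root := funext hleaf
  rw [star, slot_zero]
  simp only [slot_succ]
  rw [← this]
  exact e

/-- The root of a subtree reaches the whole subtree by forward edges. Every topological sort
therefore respects the order of the tree. -/
theorem Above.transGen : ∀ {T : StatementTree V} {x y : V}, T.labels.Nodup → T.Above x y →
    Relation.TransGen T.Forward x y
  | leaf _, _, _, _, h => h.elim
  | node k hk a ch, x, y, hn, h => by
    obtain ⟨h1, h2, -⟩ := nodup_labels_node.1 hn
    rcases h with ⟨rfl, i, h⟩ | ⟨i, h⟩
    · have hy : y ∈ (node k hk x ch).labels := mem_labels_node.2 (.inr ⟨i, h.mem⟩)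
      refine (Relation.reflTransGen_iff_eq_or_transGen.1 (reachable hy)).resolve_left ?_
      rintro rfl
      exact h1 i h.mem
    · exact Relation.TransGen.mono (fun _ _ h => .inl ⟨i, h⟩) _ _ (Above.transGen (h2 i) h)

theorem rank_lt_of_transGen [DecidableEq V] {T : StatementTree V} (hn : T.labels.Nodup) {x y : V}
    (h : Relation.TransGen T.Forward x y) : T.rank x < T.rank y := by
  induction h with
  | single h => exact rank_lt hn h
  | tail _ h ih => exact ih.trans (rank_lt hn h)

theorem rank_lt_of_back [DecidableEq V] {T : StatementTree V} (hn : T.labels.Nodup) {x y : V}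
    (h : T.Back x y) : T.rank y < T.rank x := by
  refine hn.idxOf_lt_idxOf ?_
  clear hn
  induction T with
  | leaf => exact h.elim
  | node k hk v ch ih =>
    rcases h with ⟨i, h⟩ | ⟨i, j, h, rfl, rfl⟩
    · exact ((ih i h).trans (sublist_flatten_ofFn (fun i => (ch i).labels) i)).cons _
    · have hj : j = 0 := Fin.ext h.eq.1
      cases i using Fin.cases with
      | zero => exact absurd h.2 (Nat.not_lt_zero _)
      | succ i =>
        rw [hj]
        exact .cons_cons _ (List.singleton_sublist.2
          ((sublist_flatten_ofFn (fun i => (ch i).labels) i).subset (sink_mem _)))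

theorem Above.irrefl {T : StatementTree V} {x : V} (hn : T.labels.Nodup) : ¬ T.Above x x := by
  classical
  exact fun h => (rank_lt_of_transGen hn (h.transGen hn)).false

/-- If all internal nodes are processed, each of them after those below it, then the algorithm
does not get stuck and yields a code of the tree. -/
theorem Represents.codingRun [DecidableEq V] (L : List V) : ∀ {T : StatementTree V}
    {G : RootedDigraph V} (c : V → List (CodeSymbol V)), T.Represents G →
    (∀ x, T.IsInternal x → x ∈ L) → L.Nodup → L.Pairwise (fun x y => ¬ T.Above x y) →
    (∃ c', CodingRun G c L c') ∧ ∀ c', CodingRun G c L c' → T.IsTreeCode c (c' T.root) := by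
  induction L with
  | nil =>
    intro T G c hT hL _ _
    refine ⟨⟨c, .done G c⟩, fun c' h => ?_⟩
    cases h
    have e := eq_leaf_of_forall_not_isInternal fun x hx => by simpa using hL x hx
    rw [e]
    rfl
  | cons a L ih =>
    intro T G c hT hL hn hP
    rw [List.nodup_cons] at hn
    rw [List.pairwise_cons] at hP
    by_cases ha : T.IsInternal a
    · have hA : ∀ x, T.IsInternal x → ¬ T.Above a x := by
        intro x hx h
        rcases List.mem_cons.1 (hL x hx) with rfl | hxL
        · exact Above.irrefl hT.nodup h
        · exact hP.1 x hxL h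
      obtain ⟨T', k, hk, p, rfl, rfl, hl, hi⟩ := exists_eq_graft_star hT.nodup ha hA
      have hc := hT.primeChart hl hi
      have hp := hc.isPrimeIn hk (hT.verts_subset hl hi)
      have hroot : (T'.graft (p 0) (star k hk p)).root = T'.root := by
        rw [root_graft hi]
        split_ifs with h
        · exact h.symm
        · rfl
      have ih' := fun c => ih c (hT.contract hl hi)
        (fun x hx => (List.mem_cons.1 (hL x hx.graft)).resolve_left fun e => hi (e ▸ hx)) hn.2
        (hP.2.imp fun h h' => h h'.graft)
      constructor
      · obtain ⟨σ, hσ⟩ := exists_isPrimeCode c k (inducedGraph G p)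
        obtain ⟨c', hc'⟩ := (ih' (Function.update c (p 0) (c (p 0) ++ σ))).1
        exact ⟨c', .contract G c c' (p 0) L k _ σ hp rfl hσ hc'⟩
      · intro c' hc'
        cases hc' with
        | skip _ _ _ _ _ h _ => exact absurd ⟨k, _, hp, rfl⟩ h
        | contract _ _ _ _ _ k' H' σ hH' ha' hσ hrun =>
          obtain ⟨hk', -, q, hq⟩ := hH'.exists_chart
          -- The run has no choice but to contract the star at `p 0`; only the order of equal codes
          -- remains free.
          obtain ⟨rfl, rfl⟩ := hc.unique hq hk hk' (by rw [hq.source, ha'])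
          obtain ⟨π, hπ, rfl⟩ := hc.exists_perm hk hσ
          rw [hroot]
          refine IsTreeCode.graft ?_ hi ((ih' _).2 c' hrun)
          exact ⟨π, fun i => c (p i.succ), fun i => rfl, hπ, rfl⟩
    -- A vertex that is not internal is either absent from the current graph, having been merged, or
    -- a leaf; neither is the source of a prime subgraph.
    · have hno : ¬ ∃ k H, IsPrimeIn k H G ∧ H.source = a := by
        rintro ⟨k, H, hH, rfl⟩
        obtain ⟨hk, hs, q, hq⟩ := hH.exists_chart
        have hm := (hT.mem_verts _).1 (hs H.source_mem)
        have hlf := (isLeaf_or_isInternal hm).resolve_right ha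
        exact hT.not_primeChart_of_isLeaf (hq.source ▸ hlf) hk hq
      have ih' := ih c hT (fun x hx => (List.mem_cons.1 (hL x hx)).resolve_left
        fun e => ha (e ▸ hx)) hn.2 hP.2
      obtain ⟨⟨c', hc'⟩, h⟩ := ih'
      refine ⟨⟨c', .skip G c c' a L hno hc'⟩, fun c'' hc'' => ?_⟩
      cases hc'' with
      | skip _ _ _ _ _ _ hrun => exact h c'' hrun
      | contract _ _ _ _ _ k' H' σ hH' ha' _ _ => exact absurd ⟨k', H', hH', ha'⟩ hno

section TopologicalSort

variable [DecidableEq V] {T : StatementTree V} {G : RootedDigraph V}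

theorem Represents.isTopologicalSort (hT : T.Represents G) : G.IsTopologicalSort T.labels := by
  refine ⟨hT.nodup, fun a => (hT.mem_verts a).symm, fun i j a b hi hj hab hc => ?_⟩
  rw [hT.isCycleEdge_iff] at hc
  have := hT.nodup.idxOf_lt_idxOf ((adj_iff.1 ((hT.adj a b).1 hab)).resolve_right hc).sublist_labels
  obtain ⟨hi', rfl⟩ := List.getElem?_eq_some_iff.1 hi
  obtain ⟨hj', rfl⟩ := List.getElem?_eq_some_iff.1 hj
  rwa [hT.nodup.idxOf_getElem, hT.nodup.idxOf_getElem] at this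

theorem Represents.pairwise_not_above (hT : T.Represents G) {L : List V}
    (hL : G.IsTopologicalSort L) : L.Pairwise fun x y => ¬ T.Above y x := by
  obtain ⟨hn, hm, hL⟩ := hL
  have h1 : ∀ x y, T.Forward x y → L.idxOf x < L.idxOf y := by
    intro x y h
    have hx : x ∈ L := (hm x).2 ((hT.mem_verts x).2 h.mem.1)
    have hy : y ∈ L := (hm y).2 ((hT.mem_verts y).2 h.mem.2)
    refine hL _ _ x y (List.getElem?_idxOf hx) (List.getElem?_idxOf hy)
      ((hT.adj x y).2 (adj_of_forward h)) fun hc => ?_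
    rw [hT.isCycleEdge_iff] at hc
    exact (rank_lt hT.nodup h).not_gt (rank_lt_of_back hT.nodup hc)
  have h2 : ∀ x y, Relation.TransGen T.Forward x y → L.idxOf x < L.idxOf y := by
    intro x y h
    induction h with
    | single h => exact h1 _ _ h
    | tail _ h ih => exact ih.trans (h1 _ _ h)
  refine List.pairwise_iff_getElem.2 fun i j hi hj hij hA => ?_
  have := h2 _ _ (Above.transGen hT.nodup hA)
  rw [hn.idxOf_getElem, hn.idxOf_getElem] at this
  omega

theorem Represents.isAnnotatedCode (hT : T.Represents G) :
    (∃ σ, G.IsAnnotatedCode σ) ∧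
      ∀ σ, G.IsAnnotatedCode σ → T.IsTreeCode (fun a => [.one a]) σ := by
  have key : ∀ L, G.IsTopologicalSort L → _ := fun L hL =>
    hT.codingRun L.reverse (fun a => [.one a])
      (fun x hx => List.mem_reverse.2 ((hL.2.1 x).2 ((hT.mem_verts x).2 hx.mem)))
      (List.nodup_reverse.2 hL.1) (List.pairwise_reverse.2 (hT.pairwise_not_above hL))
  constructor
  · obtain ⟨c', hc'⟩ := (key _ hT.isTopologicalSort).1
    exact ⟨_, _, c', hT.isTopologicalSort, hc', rfl⟩
  · rintro _ ⟨L, c', hL, hc', rfl⟩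
    rw [hT.source]
    exact (key L hL).2 c' hc'

end TopologicalSort

/-! ### Invariance of the code under relabelling and ties -/

section Map

variable {g : V → W}

theorem root_map : ∀ T : StatementTree V, (T.map g).root = g T.root
  | leaf _ => rfl
  | node .. => rfl

theorem sink_map : ∀ T : StatementTree V, (T.map g).sink = g T.sink
  | leaf _ => rfl
  | node k hk a ch => by
    simp only [map, sink, apply_slot g, sink_map (ch _)]

theorem labels_map : ∀ T : StatementTree V, (T.map g).labels = T.labels.map g
  | leaf _ => rfl
  | node k hk a ch => by
    simp only [map, labels, labels_map (ch _), List.map_cons, List.map_flatten, List.map_ofFn]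
    rfl

theorem rel_map {E : StatementKind → ℕ → ℕ → Prop} : ∀ {T : StatementTree V} {x y : W},
    (T.map g).Rel E x y ↔ ∃ a b, T.Rel E a b ∧ x = g a ∧ y = g b
  | leaf _, _, _ => by simp [map, Rel]
  | node k hk v ch, x, y => by
    simp only [map, Rel, rel_map (T := ch _), sink_map, root_map]
    constructor
    · rintro (⟨i, a, b, h, rfl, rfl⟩ | ⟨i, j, h, rfl, rfl⟩)
      · exact ⟨a, b, .inl ⟨i, h⟩, rfl, rfl⟩
      · exact ⟨_, _, .inr ⟨i, j, h, rfl, rfl⟩, (apply_slot g _ _ _).symm,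
          (apply_slot g _ _ _).symm⟩
    · rintro ⟨a, b, ⟨i, h⟩ | ⟨i, j, h, rfl, rfl⟩, rfl, rfl⟩
      · exact .inl ⟨i, a, b, h, rfl, rfl⟩
      · exact .inr ⟨i, j, h, apply_slot g _ _ _, apply_slot g _ _ _⟩

theorem map_id : ∀ T : StatementTree V, T.map id = T
  | leaf _ => rfl
  | node k hk a ch => by simp only [map, map_id (ch _), id]

theorem Represents.map {T : StatementTree V} {G : RootedDigraph V} {G' : RootedDigraph W}
    (hT : T.Represents G) {f : G.verts ≃ G'.verts} (hf : IsIso G G' f)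
    (hg : ∀ x : G.verts, g x = f x) : (T.map g).Represents G' where
  nodup := by
    rw [labels_map]
    refine hT.nodup.map_on fun x hx y hy h => ?_
    have hx' := (hT.mem_verts x).2 hx
    have hy' := (hT.mem_verts y).2 hy
    have : f ⟨x, hx'⟩ = f ⟨y, hy'⟩ := Subtype.ext ((hg ⟨x, hx'⟩).symm.trans (h.trans (hg ⟨y, hy'⟩)))
    simpa using f.injective this
  source := by
    rw [root_map, ← hT.source, ← hf.1]
    exact (hg ⟨_, G.source_mem⟩).symm
  mem_verts x := by
    rw [labels_map, List.mem_map]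
    constructor
    · intro hx
      obtain ⟨y, hy⟩ := f.surjective ⟨x, hx⟩
      exact ⟨y, (hT.mem_verts y).1 y.2, by rw [hg, hy]⟩
    · rintro ⟨y, hy, rfl⟩
      rw [hg ⟨y, (hT.mem_verts y).2 hy⟩]
      exact (f _).2
  adj x y := by
    refine Iff.trans ?_ rel_map.symm
    constructor
    · intro h
      obtain ⟨a, ha⟩ := f.surjective ⟨x, G'.left_mem h⟩
      obtain ⟨b, hb⟩ := f.surjective ⟨y, G'.right_mem h⟩
      refine ⟨a, b, (hT.adj a b).1 ((hf.2 a b).2 ?_), by rw [hg, ha], by rw [hg, hb]⟩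
      rwa [ha, hb]
    · rintro ⟨a, b, h, rfl, rfl⟩
      have hab := (hT.adj a b).2 h
      rw [hg ⟨a, G.left_mem hab⟩, hg ⟨b, G.right_mem hab⟩]
      exact (hf.2 ⟨a, _⟩ ⟨b, _⟩).1 hab

end Map

section Uniqueness

/-- Sorting gives the same list of words whatever the order of equal words. -/
theorem sorted_unique : ∀ {m : ℕ} {s : Fin m → List (CodeSymbol V)}
    {s' : Fin m → List (CodeSymbol W)} {π π' : Equiv.Perm (Fin m)}, SortsCodes π s →
    SortsCodes π' s' → (∀ i, plainCode (s i) = plainCode (s' i)) →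
    ∀ i, plainCode (s (π i)) = plainCode (s' (π' i))
  | 0, _, _, _, _, _, _, _, i => i.elim0
  | n + 1, s, s', π, π', ⟨hl, hs⟩, ⟨hl', hs'⟩, e, i => by
    have hlast : ∀ j : Fin (n + 1), (j : ℕ) + 1 = n + 1 → j = Fin.last n := fun j h =>
      Fin.ext (by simpa using h)
    have hp := (Equiv.Perm.ofFn_comp_perm π fun i => plainCode (s i)).trans
      ((List.ofFn_injective.eq_iff.2 (funext e) ▸ List.Perm.refl _ :
        List.Perm (List.ofFn fun i => plainCode (s i)) (List.ofFn fun i => plainCode (s' i))).trans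
        (Equiv.Perm.ofFn_comp_perm π' fun i => plainCode (s' i)).symm)
    rw [List.ofFn_succ', List.ofFn_succ', List.concat_eq_append, List.concat_eq_append] at hp
    simp only [Function.comp, hl (Fin.last n) (by simp), hl' (Fin.last n) (by simp), e] at hp
    -- The common last word is cancelled; the remaining words are two sorted permutations of each
    -- other, hence equal lists.
    rw [List.perm_append_right_iff] at hp
    simp only [← e (π _)] at hp
    have := hp.eq_of_pairwise' (r := (· ≤ ·))
      (List.pairwise_ofFn.2 fun i j hij => hs _ _ (by simpa using hij) (by simp))
      (List.pairwise_ofFn.2 fun i j hij => hs' _ _ (by simpa using hij) (by simp))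
    cases i using Fin.lastCases with
    | last => rw [hl _ (by simp), hl' _ (by simp), e]
    | cast i => exact congrFun (List.ofFn_injective this) i

theorem plainCode_append (σ τ : List (CodeSymbol V)) :
    plainCode (σ ++ τ) = plainCode σ ++ plainCode τ :=
  List.map_append

theorem plainCode_cons (a : CodeSymbol V) (τ : List (CodeSymbol V)) :
    plainCode (a :: τ) = a.toNat :: plainCode τ :=
  rfl

theorem plainCode_flatten_ofFn {m : ℕ} (s : Fin m → List (CodeSymbol V)) :
    plainCode (List.ofFn s).flatten = (List.ofFn fun i => plainCode (s i)).flatten := by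
  simp only [plainCode, List.map_flatten, List.map_ofFn]
  rfl

/-- By recursion corresponding branches have equal plain codes, and sorting equal families gives
equal lists. With `g` the identity this is independence of the run; with an isomorphism it is
invariance. -/
theorem IsTreeCode.unique {c : V → List (CodeSymbol V)} {c' : W → List (CodeSymbol W)} {g : V → W}
    (hc : ∀ a, plainCode (c a) = plainCode (c' (g a))) : ∀ {T : StatementTree V}
    {σ : List (CodeSymbol V)} {σ' : List (CodeSymbol W)}, T.IsTreeCode c σ →
    (T.map g).IsTreeCode c' σ' → plainCode σ = plainCode σ'
  | leaf a, σ, σ', h, h' => by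
    change σ = _ at h
    change σ' = _ at h'
    rw [h, h', hc]
  | node k hk a ch, σ, σ', ⟨π, s, h1, h2, h3⟩, ⟨π', s', h1', h2', h3'⟩ => by
    have e := sorted_unique h2 h2' fun i => IsTreeCode.unique hc (h1 i) (h1' i)
    rw [h3, h3', plainCode_append, plainCode_append, hc, plainCode_cons, plainCode_cons,
      plainCode_flatten_ofFn, plainCode_flatten_ofFn, funext e]
    rfl

end Uniqueness

/-- The code of the tree with its branches in the given order. -/
def code : StatementTree V → List (CodeSymbol V)
  | leaf a => [.one a]
  | node k _ a ch => .one a :: .kind k.typeNumber :: (List.ofFn fun i => (ch i).code).flatten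

/-! ### Rearranging branches so that a code is read off in preorder -/

section Reorder

/-- Only if-then-else and case graphs have several inner vertices, and there all of them have the
same neighbours. -/
theorem edge_iff_of_fixes {k : StatementKind} {i j i' j' : ℕ} (hi : i ≤ k.lastVertex)
    (hj : j ≤ k.lastVertex) (hi' : i' ≤ k.lastVertex) (hj' : j' ≤ k.lastVertex)
    (h1 : i' = 0 ↔ i = 0) (h2 : i' = k.lastVertex ↔ i = k.lastVertex) (h3 : j' = 0 ↔ j = 0)
    (h4 : j' = k.lastVertex ↔ j = k.lastVertex) : k.Edge i' j' ↔ k.Edge i j := by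
  cases k <;> grind [StatementKind.Edge, StatementKind.lastVertex]

/-- The extension of a permutation of the vertices other than the source to all vertices. -/
def extendPerm {m : ℕ} (π : Equiv.Perm (Fin m)) (i : Fin (m + 1)) : Fin (m + 1) :=
  slot 0 (fun i => (π i).succ) i

theorem slot_comp_perm {m : ℕ} (π : Equiv.Perm (Fin m)) (a : V) (f : Fin m → V)
    (i : Fin (m + 1)) : slot a (fun i => f (π i)) i = slot a f (extendPerm π i) := by
  cases i using Fin.cases <;> rfl

theorem extendPerm_eq_zero {m : ℕ} (π : Equiv.Perm (Fin m)) (i : Fin (m + 1)) :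
    (extendPerm π i : ℕ) = 0 ↔ (i : ℕ) = 0 := by
  cases i using Fin.cases <;> simp [extendPerm]

theorem extendPerm_symm {m : ℕ} (π : Equiv.Perm (Fin m)) (i : Fin (m + 1)) :
    extendPerm π (extendPerm π.symm i) = i := by
  cases i using Fin.cases <;> simp [extendPerm]

theorem extendPerm_eq_last {m : ℕ} {π : Equiv.Perm (Fin m)}
    (hπ : ∀ i : Fin m, (i : ℕ) + 1 = m → π i = i) (i : Fin (m + 1)) :
    (extendPerm π i : ℕ) = m ↔ (i : ℕ) = m := by
  cases i using Fin.cases with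
  | zero => simp [extendPerm]
  | succ i =>
    simp only [extendPerm, slot_succ, Fin.val_succ]
    constructor
    · intro h
      rw [π.injective (hπ _ h)] at h
      exact h
    · intro h
      rw [hπ i h]
      exact h

/-- The permutation chosen by the sorting is applied to the branches themselves. It fixes the sink
slot and the source, so by `edge_iff_of_fixes` the described graph does not change. -/
theorem IsTreeCode.exists_reorder : ∀ {T : StatementTree V} {σ : List (CodeSymbol V)},
    T.IsTreeCode (fun a => [.one a]) σ → T.labels.Nodup → ∃ T' : StatementTree V,
      T'.labels.Nodup ∧ T'.root = T.root ∧ T'.sink = T.sink ∧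
      (∀ x, x ∈ T'.labels ↔ x ∈ T.labels) ∧ (∀ x y, T'.Adj x y ↔ T.Adj x y) ∧ σ = T'.code
  | leaf a, σ, h, hn => ⟨leaf a, hn, rfl, rfl, fun _ => Iff.rfl, fun _ _ => Iff.rfl, h⟩
  | node k hk a ch, σ, ⟨π, s, h1, h2, h3⟩, hn => by
    obtain ⟨hn1, hn2, hn3⟩ := nodup_labels_node.1 hn
    choose ch' hn' hr hs hm ha hc using fun i => IsTreeCode.exists_reorder (h1 i) (hn2 i)
    refine ⟨node k hk a fun i => ch' (π i), ?_, rfl, ?_, fun x => ?_, fun x y => ?_, ?_⟩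
    · rw [nodup_labels_node]
      refine ⟨fun i h => hn1 _ ((hm _ _).1 h), fun i => hn' _, fun i j x hi hj => ?_⟩
      exact π.injective (hn3 _ _ x ((hm _ _).1 hi) ((hm _ _).1 hj))
    · simp only [sink, hs]
      rw [slot_comp_perm π a fun i => (ch i).sink]
      congr 1
      exact Fin.ext ((extendPerm_eq_last h2.1 _).2 rfl)
    · simp only [mem_labels_node, hm]
      rw [π.exists_congr_left]
      simp
    · change Rel _ _ _ _ ↔ Rel _ _ _ _
      have hE : ∀ i j, k.Edge (extendPerm π i) (extendPerm π j) ↔ k.Edge i j := fun i j =>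
        edge_iff_of_fixes (Nat.lt_succ_iff.1 i.2) (Nat.lt_succ_iff.1 j.2)
          (Nat.lt_succ_iff.1 (extendPerm π i).2) (Nat.lt_succ_iff.1 (extendPerm π j).2)
          (extendPerm_eq_zero π i) (extendPerm_eq_last h2.1 i) (extendPerm_eq_zero π j)
          (extendPerm_eq_last h2.1 j)
      simp only [Rel, hs, hr, slot_comp_perm π a fun i => (ch i).sink,
        slot_comp_perm π a fun i => (ch i).root]
      refine or_congr ?_ ?_
      · constructor
        · rintro ⟨i, h⟩
          exact ⟨π i, (ha _ _ _).1 h⟩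
        · rintro ⟨i, h⟩
          exact ⟨π.symm i, (ha _ _ _).2 (by simpa using h)⟩
      · constructor
        · rintro ⟨i, j, h, e⟩
          exact ⟨_, _, (hE i j).2 h, e⟩
        · rintro ⟨i, j, h, e⟩
          refine ⟨extendPerm π.symm i, extendPerm π.symm j, ?_, ?_⟩
          · rwa [← hE, extendPerm_symm, extendPerm_symm]
          · rwa [extendPerm_symm, extendPerm_symm]
    · rw [h3]
      simp only [hc, code]
      rfl

theorem Represents.exists_reorder {T : StatementTree V} {G : RootedDigraph V}
    (hT : T.Represents G) {σ : List (CodeSymbol V)} (hσ : T.IsTreeCode (fun a => [.one a]) σ) :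
    ∃ T' : StatementTree V, T'.Represents G ∧ σ = T'.code := by
  obtain ⟨T', h1, h2, -, h3, h4, h5⟩ := hσ.exists_reorder hT.nodup
  exact ⟨T', ⟨h1, by rw [hT.source, h2], fun x => by rw [hT.mem_verts, h3],
    fun x y => by rw [hT.adj, h4]⟩, h5⟩

end Reorder

/-! ### Parsing a code -/

section Code

theorem one_mem_code : ∀ {T : StatementTree V} {a : V}, .one a ∈ T.code ↔ a ∈ T.labels
  | leaf _, _ => by simp [code]
  | node k hk b ch, a => by
    simp only [code, List.mem_cons, List.mem_flatten, List.mem_ofFn, mem_labels_node,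
      ← one_mem_code (T := ch _)]
    simp

theorem two_le_of_kind_mem_code : ∀ {T : StatementTree V} {n : ℕ}, .kind n ∈ T.code → 2 ≤ n
  | leaf _, _, h => by simp [code] at h
  | node k hk b ch, n, h => by
    simp only [code, List.mem_cons, List.mem_flatten, List.mem_ofFn] at h
    rcases h with h | h | ⟨_, ⟨i, rfl⟩, h⟩
    · cases h
    · cases h
      exact StatementKind.two_le_typeNumber hk
    · exact two_le_of_kind_mem_code h

theorem plainCode_getElem?_eq_one {T : StatementTree V} {i : ℕ} :
    (plainCode T.code)[i]? = some 1 ↔ ∃ a, T.code[i]? = some (.one a) := by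
  rw [plainCode, List.getElem?_map, Option.map_eq_some_iff]
  constructor
  · rintro ⟨x, hx, h⟩
    cases x with
    | one a => exact ⟨a, hx⟩
    | kind n =>
      have := two_le_of_kind_mem_code (List.mem_of_getElem? hx)
      simp only [CodeSymbol.toNat] at h
      omega
  · rintro ⟨a, ha⟩
    exact ⟨_, ha, rfl⟩

/-- The vertex to which a symbol belongs. -/
def _root_.CodeSymbol.vertex? : CodeSymbol V → Option V
  | .one a => some a
  | .kind _ => none

theorem filterMap_code : ∀ T : StatementTree V, T.code.filterMap CodeSymbol.vertex? = T.labels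
  | leaf _ => rfl
  | node k hk b ch => by
    change b :: List.filterMap _ (List.ofFn fun i => (ch i).code).flatten = _
    rw [labels, List.filterMap_flatten, List.map_ofFn]
    simp only [Function.comp_def, filterMap_code (ch _)]

/-- Without the type symbols the code is the list of labels, so distinct labels mean distinct
annotations. -/
theorem code_position_unique {T : StatementTree V} (hn : T.labels.Nodup) {i j : ℕ} {a : V}
    (hi : T.code[i]? = some (.one a)) (hj : T.code[j]? = some (.one a)) : i = j := by
  rw [← filterMap_code, List.Nodup, List.pairwise_filterMap, List.pairwise_iff_getElem] at hn
  obtain ⟨hi', hi⟩ := List.getElem?_eq_some_iff.1 hi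
  obtain ⟨hj', hj⟩ := List.getElem?_eq_some_iff.1 hj
  rcases lt_trichotomy i j with h | h | h
  · exact absurd rfl (hn i j hi' hj' h a (by simp [hi, CodeSymbol.vertex?]) a
      (by simp [hj, CodeSymbol.vertex?]))
  · exact h
  · exact absurd rfl (hn j i hj' hi' h a (by simp [hj, CodeSymbol.vertex?]) a
      (by simp [hi, CodeSymbol.vertex?]))

/-- Relabel a symbol. -/
def _root_.CodeSymbol.map (g : V → W) : CodeSymbol V → CodeSymbol W
  | .one a => .one (g a)
  | .kind n => .kind n

theorem code_map {g : V → W} : ∀ T : StatementTree V,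
    (T.map g).code = T.code.map (CodeSymbol.map g)
  | leaf _ => rfl
  | node k hk a ch => by
    simp only [map, code, code_map (ch _), List.map_cons, List.map_flatten, List.map_ofFn]
    rfl

theorem exists_code_eq_cons (T : StatementTree V) : ∃ l, plainCode T.code = 1 :: l := by
  cases T <;> exact ⟨_, rfl⟩

/-- What follows a branch is another branch, starting with 1, or the remainder `r`. It thus cannot
be mistaken for a type. -/
theorem head?_lt_two {n : ℕ} (f : Fin n → StatementTree V) {r : List ℕ}
    (hr : ∀ n ∈ r.head?, n < 2) :
    ∀ n ∈ ((List.ofFn fun i => plainCode (f i).code).flatten ++ r).head?, n < 2 := by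
  cases n with
  | zero => simpa using hr
  | succ n =>
    obtain ⟨l, hl⟩ := exists_code_eq_cons (f 0)
    simp [List.ofFn_succ, hl]

/-- Parsing: the plain code determines the tree up to its labels. -/
theorem exists_pairing_flatten {m : ℕ} {f : Fin m → StatementTree V} {P : Fin m →
    StatementTree W → Prop} (ih : ∀ (i : Fin m) (T' : StatementTree W) (r r' : List ℕ),
      (∀ n ∈ r.head?, n < 2) → (∀ n ∈ r'.head?, n < 2) →
      plainCode (f i).code ++ r = plainCode T'.code ++ r' → P i T' ∧ r = r')
    {f' : Fin m → StatementTree W} {r r' : List ℕ}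
    (hr : ∀ n ∈ r.head?, n < 2) (hr' : ∀ n ∈ r'.head?, n < 2)
    (h : (List.ofFn fun i => plainCode (f i).code).flatten ++ r =
      (List.ofFn fun i => plainCode (f' i).code).flatten ++ r') :
    (∀ i, P i (f' i)) ∧ r = r' := by
  induction m with
  | zero => exact ⟨fun i => i.elim0, by simpa using h⟩
  | succ m IH =>
    rw [List.ofFn_succ, List.ofFn_succ, List.flatten_cons, List.flatten_cons, List.append_assoc,
      List.append_assoc] at h
    obtain ⟨h0, h⟩ := ih 0 (f' 0) _ _ (head?_lt_two _ hr) (head?_lt_two _ hr') h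
    obtain ⟨h1, h⟩ := IH (fun i => ih i.succ) h
    exact ⟨fun i => Fin.cases h0 h1 i, h⟩

/-- The symbol after the leading 1 decides the shape: a number from 2 on is the type of an internal
node and fixes its number of branches, anything else means a leaf. The remainders `r`, `r'` allow
for recursion, and `Q` carries both labellings on the common shape. -/
theorem exists_pairing : ∀ (T : StatementTree V) (T' : StatementTree W) (r r' : List ℕ),
    (∀ n ∈ r.head?, n < 2) → (∀ n ∈ r'.head?, n < 2) →
    plainCode T.code ++ r = plainCode T'.code ++ r' →
    (∃ Q : StatementTree (V × W), Q.map Prod.fst = T ∧ Q.map Prod.snd = T') ∧ r = r'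
  | leaf a, leaf b, r, r', _, _, h => by
    refine ⟨⟨leaf (a, b), rfl, rfl⟩, ?_⟩
    simpa [code, plainCode, CodeSymbol.toNat] using h
  | leaf a, node k hk b ch, r, r', hr, _, h => by
    have hk' := StatementKind.two_le_typeNumber hk
    simp only [code, plainCode, List.map_cons, CodeSymbol.toNat, List.cons_append, List.cons.injEq,
      true_and, List.map_nil, List.nil_append] at h
    have := hr k.typeNumber (by simp [h])
    omega
  | node k hk b ch, leaf a, r, r', _, hr', h => by
    have hk' := StatementKind.two_le_typeNumber hk
    simp only [code, plainCode, List.map_cons, CodeSymbol.toNat, List.cons_append, List.cons.injEq,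
      true_and, List.map_nil, List.nil_append] at h
    have := hr' k.typeNumber (by simp [← h])
    omega
  | node k hk a ch, node k' hk' b ch', r, r', hr, hr', h => by
    simp only [code, plainCode_cons, CodeSymbol.toNat, List.cons_append, List.cons.injEq,
      true_and] at h
    obtain ⟨hkk, h⟩ := h
    obtain rfl := StatementKind.typeNumber_injective hkk
    rw [plainCode_flatten_ofFn, plainCode_flatten_ofFn] at h
    obtain ⟨h1, h2⟩ := exists_pairing_flatten (fun i => exists_pairing (ch i)) hr hr' h
    choose Q hQ hQ' using h1
    refine ⟨⟨node k hk (a, b) Q, ?_, ?_⟩, h2⟩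
    · simp only [map, hQ]
    · simp only [map, hQ']

end Code

/-! ### Trees of Dijkstra graphs, and the theorem -/

variable [DecidableEq V]

theorem exists_represents_of_isLabeledDijkstra {G : RootedDigraph V} {X : Finset V}
    (h : IsLabeledDijkstra G X) :
    ∃ T : StatementTree V, T.Represents G ∧ ∀ x, x ∈ X ↔ T.IsLeaf x := by
  induction h with
  | trivial G hverts hadj =>
    refine ⟨leaf G.source, ⟨List.nodup_singleton _, rfl, fun x => ?_, fun x y => ?_⟩, fun x => ?_⟩
    · rw [hverts, Finset.mem_singleton, mem_labels_leaf]
    · exact iff_of_false (hadj x y) fun h => h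
    · exact Finset.mem_singleton
  | expand G H G' X a t k _ ha hk hH hG' ih =>
    obtain ⟨T, hT, hX⟩ := ih
    obtain ⟨f, hf⟩ := hH
    obtain ⟨p, hp, hp0, hv, hadj, -⟩ := exists_enumeration hf
    obtain ⟨haG, hd, ht, hverts, hsource, hG'⟩ := hG'
    obtain rfl := eq_last_of_isSink ht hp hv hadj
    have hl := (hX a).1 ha
    have hi := hl.not_isInternal hT.nodup
    have hS : ∀ x y, (star k hk p).Adj x y ↔ H.Adj x y := by
      intro x y
      refine rel_star.trans ⟨?_, fun h => ?_⟩
      · rintro ⟨i, j, h, rfl, rfl⟩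
        exact (hadj i j).2 h
      · obtain ⟨i, rfl⟩ := (hv x).1 (H.left_mem h)
        obtain ⟨j, rfl⟩ := (hv y).1 (H.right_mem h)
        exact ⟨i, j, (hadj i j).1 h, rfl, rfl⟩
    refine ⟨T.graft a (star k hk p), ⟨?_, ?_, fun x => ?_, fun x y => ?_⟩, fun x => ?_⟩
    · refine (nodup_labels_graft hl hi).2 ⟨hT.nodup, nodup_labels_star.2 hp, fun x hx hxa hxS => ?_⟩
      refine Finset.disjoint_left.1 hd (Finset.mem_sdiff.2 ⟨(hT.mem_verts x).2 hx, ?_⟩)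
        ((hv x).2 (mem_labels_star.1 hxS))
      simpa using hxa
    · rw [hsource, root_graft hi, hT.source, ← hp0]
      rfl
    · rw [hverts, mem_labels_graft hi, Finset.mem_union, Finset.mem_sdiff, hT.mem_verts,
        Finset.mem_singleton, hv, mem_labels_star]
      simp [hl.mem]
    · rw [hG']
      refine Iff.trans ?_ (rel_graft hi).symm
      simp only [hl, true_and, hS, sink_star, root_star]
      change _ ↔ H.Adj x y ∨ ∃ x₀ y₀, T.Adj x₀ y₀ ∧ _
      simp only [← hT.adj, hp0]
      constructor
      · rintro (⟨hx, hy, h⟩ | h | ⟨hx, h, rfl⟩ | ⟨rfl, hy, h⟩)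
        · exact .inr ⟨x, y, h, by simp [hx], by simp [hy]⟩
        · exact .inl h
        · exact .inr ⟨x, a, h, by simp [hx], by simp⟩
        · exact .inr ⟨a, y, h, by simp, by simp [hy]⟩
      · rintro (h | ⟨x₀, y₀, h, rfl, rfl⟩)
        · exact .inr (.inl h)
        -- There are no loops, so tail and head of an old edge are not both `a`, the one combination
        -- missing from `IsExpansion`.
        · have hne := Rel.ne hT.nodup ((hT.adj _ _).1 h)
          by_cases hx : x₀ = a
          · have hy : y₀ ≠ a := fun e => hne (hx.trans e.symm)
            subst hx
            simp [hy, h]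
          · by_cases hy : y₀ = a
            · subst hy
              simp [hx, h]
            · simp [hx, hy, h]
    · rw [Finset.mem_union, Finset.mem_sdiff, Finset.mem_sdiff, Finset.mem_singleton,
        Finset.mem_singleton, hX, isLeaf_graft, isLeaf_star, hv, ← hp0]
      refine or_congr_right ?_
      simp only [hl, true_and]
      constructor
      · rintro ⟨⟨i, rfl⟩, hne⟩
        cases i using Fin.cases with
        | zero => exact absurd rfl hne
        | succ i => exact ⟨i, rfl⟩
      · rintro ⟨i, rfl⟩
        exact ⟨⟨_, rfl⟩, fun e => Fin.succ_ne_zero i (hp e)⟩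

theorem exists_represents {G : RootedDigraph V} (hG : G.IsDijkstra) :
    ∃ T : StatementTree V, T.Represents G := by
  obtain ⟨X, hX⟩ := hG
  obtain ⟨T, hT, -⟩ := exists_represents_of_isLabeledDijkstra hX
  exact ⟨T, hT⟩

omit [DecidableEq V] in
/-- The `1`s of the code of a tree correspond to the vertices. -/
theorem Represents.exists_equiv {T : StatementTree V} {G : RootedDigraph V}
    (hT : T.Represents G) : ∃ e : {i : ℕ // (plainCode T.code)[i]? = some 1} ≃ G.verts,
      ∀ i : {i : ℕ // (plainCode T.code)[i]? = some 1}, T.code[i.val]? = some (.one (e i : V)) := by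
  choose f hf using fun i : {i : ℕ // (plainCode T.code)[i]? = some 1} =>
    plainCode_getElem?_eq_one.1 i.2
  have hm : ∀ i, f i ∈ G.verts := fun i =>
    (hT.mem_verts _).2 (one_mem_code.1 (List.mem_of_getElem? (hf i)))
  refine ⟨Equiv.ofBijective (fun i => ⟨f i, hm i⟩) ⟨fun i j hij => ?_, ?_⟩, hf⟩
  · have e : f i = f j := congrArg Subtype.val hij
    exact Subtype.ext (code_position_unique hT.nodup (hf i) (e ▸ hf j))
  · rintro ⟨x, hx⟩
    obtain ⟨i, hi⟩ := List.mem_iff_getElem?.1 (one_mem_code.2 ((hT.mem_verts x).1 hx))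
    refine ⟨⟨i, plainCode_getElem?_eq_one.2 ⟨x, hi⟩⟩, Subtype.ext ?_⟩
    have := hf ⟨i, plainCode_getElem?_eq_one.2 ⟨x, hi⟩⟩
    simp only [hi, Option.some.injEq, CodeSymbol.one.injEq] at this
    exact this.symm

omit [DecidableEq V] in
/-- Trees with the same plain code describe isomorphic graphs. -/
theorem Represents.exists_iso {T : StatementTree V} {T' : StatementTree W} {G : RootedDigraph V}
    {G' : RootedDigraph W} (hT : T.Represents G) (hT' : T'.Represents G')
    (h : plainCode T.code = plainCode T'.code) :
    ∃ f : G.verts ≃ G'.verts, IsIso G G' f ∧ ∀ (v : G.verts) (v' : G'.verts), f v = v' ↔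
      ∃ i : ℕ, T.code[i]? = some (.one (v : V)) ∧ T'.code[i]? = some (.one (v' : W)) := by
  obtain ⟨⟨Q, rfl, rfl⟩, -⟩ := exists_pairing T T' [] [] (by simp) (by simp) (by rw [h])
  have hn1 := hT.nodup
  have hn2 := hT'.nodup
  rw [labels_map] at hn1 hn2
  -- Both projections are injective on the labels of `Q`, so these pairs form the graph of a
  -- bijection between the vertex sets.
  have inj1 := List.inj_on_of_nodup_map hn1
  have inj2 := List.inj_on_of_nodup_map hn2
  have m1 : ∀ x, x ∈ G.verts ↔ ∃ q ∈ Q.labels, q.1 = x := fun x => by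
    rw [hT.mem_verts, labels_map, List.mem_map]
  have m2 : ∀ x, x ∈ G'.verts ↔ ∃ q ∈ Q.labels, q.2 = x := fun x => by
    rw [hT'.mem_verts, labels_map, List.mem_map]
  choose q hq hq1 using fun v : G.verts => (m1 v).1 v.2
  let f : G.verts → G'.verts := fun v => ⟨(q v).2, (m2 _).2 ⟨_, hq v, rfl⟩⟩
  have hf : ∀ (v : G.verts) (w : W), (v.1, w) ∈ Q.labels ↔ (f v : W) = w := by
    intro v w
    constructor
    · intro hw
      have := inj1 (hq v) hw (hq1 v)
      exact congrArg Prod.snd this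
    · rintro rfl
      have : q v = (v.1, (f v : W)) := Prod.ext (hq1 v) rfl
      exact this ▸ hq v
  have hbij : Function.Bijective f := by
    constructor
    · intro v w hvw
      have h1 := (hf v (f v)).2 rfl
      have h2 := (hf w (f v)).2 (congrArg Subtype.val hvw).symm
      exact Subtype.ext (congrArg Prod.fst (inj2 h1 h2 rfl))
    · rintro ⟨w, hw⟩
      obtain ⟨⟨a, b⟩, hab, rfl⟩ := (m2 w).1 hw
      exact ⟨⟨a, (m1 a).2 ⟨_, hab, rfl⟩⟩, Subtype.ext ((hf ⟨a, _⟩ b).1 hab)⟩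
  refine ⟨Equiv.ofBijective f hbij, ⟨?_, fun a b => ?_⟩, fun v v' => ?_⟩
  · refine (hf _ _).1 ?_
    simp only [hT.source, hT'.source, root_map]
    exact root_mem Q
  · change _ ↔ G'.Adj (f a) (f b)
    rw [hT.adj, hT'.adj]
    -- The edges on both sides are projections of the edges of `Q`.
    refine rel_map.trans (Iff.trans ?_ rel_map.symm)
    have hx : ∀ (v : G.verts) (x : V × W), x ∈ Q.labels → (v.1 = x.1 ↔ (f v : W) = x.2) := by
      intro v x hx
      constructor
      · intro e
        refine (hf v _).1 ?_
        rwa [e]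
      · intro e
        exact congrArg Prod.fst (inj2 ((hf v _).2 e) hx rfl)
    refine exists_congr fun x => exists_congr fun y => ?_
    refine and_congr_right fun hR => ?_
    rw [hx a x hR.mem.1, hx b y hR.mem.2]
  · rw [Subtype.ext_iff]
    change (f v : W) = v' ↔ _
    rw [← hf, ← one_mem_code, List.mem_iff_getElem?]
    refine exists_congr fun i => ?_
    rw [code_map, code_map, List.getElem?_map, List.getElem?_map]
    cases Q.code[i]? with
    | none => simp
    | some s =>
      cases s with
      | one x =>
        simp only [Option.map_some, CodeSymbol.map, Option.some.injEq, CodeSymbol.one.injEq,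
          Prod.ext_iff]
      | kind n => simp [CodeSymbol.map]

end StatementTree

theorem mainTheorem5 {V : Type u} {V' : Type v} [DecidableEq V] [DecidableEq V']
    (G : RootedDigraph V) (G' : RootedDigraph V') (hG : G.IsDijkstra) (hG' : G'.IsDijkstra) :
    -- the code `C(G)` exists and does not depend on the choices made by the algorithm
    (∃! C, G.IsCode C) ∧
    -- the `1`s of the code correspond bijectively to the vertices
    (∀ σ, G.IsAnnotatedCode σ →
      ∃ e : {i : ℕ // (plainCode σ)[i]? = some 1} ≃ G.verts,
        ∀ i : {i : ℕ // (plainCode σ)[i]? = some 1}, σ[i.val]? = some (.one (e i : V))) ∧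
    -- if the codes are equal, then mapping the vertices according to the positions of the `1`s
    -- is an isomorphism
    (∀ σ σ', G.IsAnnotatedCode σ → G'.IsAnnotatedCode σ' → plainCode σ = plainCode σ' →
      ∃ f : G.verts ≃ G'.verts, RootedDigraph.IsIso G G' f ∧
        ∀ (v : G.verts) (v' : G'.verts), f v = v' ↔
          ∃ i : ℕ, σ[i]? = some (.one (v : V)) ∧ σ'[i]? = some (.one (v' : V'))) ∧
    -- the code represents the graph
    (∀ C C', G.IsCode C → G'.IsCode C' →
      (C = C' ↔ ∃ f : G.verts ≃ G'.verts, RootedDigraph.IsIso G G' f)) := by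
  obtain ⟨T, hT⟩ := StatementTree.exists_represents hG
  obtain ⟨T', hT'⟩ := StatementTree.exists_represents hG'
  obtain ⟨⟨σ₀, hσ₀⟩, hcode⟩ := hT.isAnnotatedCode
  have hcode' := hT'.isAnnotatedCode.2
  have hiso : ∀ σ σ', G.IsAnnotatedCode σ → G'.IsAnnotatedCode σ' → plainCode σ = plainCode σ' →
      ∃ f : G.verts ≃ G'.verts, RootedDigraph.IsIso G G' f ∧
        ∀ (v : G.verts) (v' : G'.verts), f v = v' ↔
          ∃ i : ℕ, σ[i]? = some (.one (v : V)) ∧ σ'[i]? = some (.one (v' : V')) := by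
    intro σ σ' hσ hσ' h
    obtain ⟨S, hS, rfl⟩ := hT.exists_reorder (hcode σ hσ)
    obtain ⟨S', hS', rfl⟩ := hT'.exists_reorder (hcode' σ' hσ')
    exact hS.exists_iso hS' h
  refine ⟨⟨plainCode σ₀, ⟨σ₀, hσ₀, rfl⟩, ?_⟩, fun σ hσ => ?_, hiso, ?_⟩
  · rintro _ ⟨σ, hσ, rfl⟩
    refine StatementTree.IsTreeCode.unique (g := id) (fun _ => rfl) (hcode σ hσ) ?_
    rw [StatementTree.map_id]
    exact hcode σ₀ hσ₀
  · obtain ⟨S, hS, rfl⟩ := hT.exists_reorder (hcode σ hσ)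
    exact hS.exists_equiv
  · rintro _ _ ⟨σ, hσ, rfl⟩ ⟨σ', hσ', rfl⟩
    constructor
    · intro h
      obtain ⟨f, hf, -⟩ := hiso σ σ' hσ hσ' h
      exact ⟨f, hf⟩
    · rintro ⟨f, hf⟩
      -- Outside the vertices of `G` the value is arbitrary.
      let g : V → V' := fun x => if hx : x ∈ G.verts then f ⟨x, hx⟩ else G'.source
      have hg : ∀ x : G.verts, g x = f x := fun x => by simp [g]
      -- The relabelled tree of `G` represents `G'`, so `σ'` is one of its codes; the tree `T'` is
      -- not needed here.
      exact StatementTree.IsTreeCode.unique (g := g) (fun _ => rfl) (hcode σ hσ)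
        ((hT.map hf hg).isAnnotatedCode.2 σ' hσ')
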